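/- Maps are cellular embeddings of connected graphs (loops and multiple edges allowed) in oriented closed surfaces, up to orientation-preserving homeomorphism, described combinatorially as connected graphs with a rotation system (a cyclic clockwise order of the half-edges around each vertex), up to isomorphism. Let $k\ge 1$. Types $t\in\{1,\dots,k\}$ are taken modulo $k$. A *$k$-constellation* is a map with black and white faces and $k$ types of vertices such that each edge separates a black face from a white face, and each black face (*hyperedge*) has degree $k$ and is incident to vertices of types $1,2,\dots,k$ in this order clockwise around the face. Its *size* is the number of hyperedges. An edge has *type* $t$ if, clockwise around its hyperedge, it goes from a vertex of type $t$ to a vertex of type $t+1$. A constellation is *rooted* if one hyperedge is distinguished; the *root vertex* is the vertex of type $k$ incident to this hyperedge. A *$k$-cactus* is a $k$-constellation with a single white face. It is *$(p_1,\dots,p_k)$-colored* if its vertices are colored so that, for every $t$, the colors of the vertices of type $t$ are exactly the elements of $[p_t]=\{1,\dots,p_t\}$. A constellation is of *type* $(p_1,\dots,p_k)$ and *vertex-labelled* if for every $t$ it has $p_t$ vertices of type $t$, carrying distinct labels in $[p_t]$. For a vertex $v_0$, a *$v_0$-arborescence* is a spanning tree $A$ such that every vertex $v\ne v_0$ of type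 $t$ is incident to exactly one edge of type $t$ in $A$. A *tree-rooted constellation* is a rooted constellation together with a $v_0$-arborescence, where $v_0$ is the root vertex. A *$(p_1,\dots,p_k)$-colored factorization of $(1,2,\dots,n)$* consists of permutations $\pi_1,\dots,\pi_k$ of $[n]$ with $\pi_1\circ\cdots\circ\pi_k=(1,2,\dots,n)$ and surjections $\phi_t:[n]\to[p_t]$, $t=1,\dots,k$, such that $\phi_t$ is constant on each cycle of $\pi_t$. **Theorem.** Let $p_1,\dots,p_k$ be positive integers and let $n\ge 0$. (a) The $(p_1,\dots,p_k)$-colored rooted $k$-cacti of size $n$ are in bijection with the $(p_1,\dots,p_k)$-colored factorizations of $(1,2,\dots,n)$: there is a bijection under which $(\pi_1,\dots,\pi_k,\phi_1,\dots,\phi_k)$ corresponds to $C$ if and only if the hyperedges of $C$ can be labelled bijectively by $[n]$, the root hyperedge getting label $1$, in such a way that for every $t$ the cycles of $\pi_t$ are the counterclockwise orders of the hyperedges around the vertices of type $t$, and $\phi_t(a)$ is the color of the vertex of type $t$ incident to the hyperedge labelled $a$. (b) There is a bijection $\Phi$ from the set of $(p_1,\dots,p_k)$-colored rooted $k$-cacti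 of size $n$ to the set of vertex-labelled tree-rooted $k$-constellations of size $n$ and type $(p_1,\dots,p_k)$ which is degree preserving: for every colored rooted cactus $C$, every type $t$ and all $i\in[p_t]$, $j\in[p_{t+1}]$, the number of edges of type $t$ of $C$ joining a vertex of type $t$ and color $i$ to a vertex of type $t+1$ and color $j$ is equal to the number of edges of type $t$ of $\Phi(C)$ joining the vertex of type $t$ labelled $i$ to the vertex of type $t+1$ labelled $j$. -/

import Mathlib

namespace TreeRooted

/-- A map (with at least one edge): a connected finite graph, loops and multiple edges allowed,
cellularly embedded in an oriented closed surface, in its combinatorial form. It is a connected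
graph given by its half-edges together with a rotation system: `rot` sends a half-edge to the next
half-edge in clockwise order around its vertex, and `opp` exchanges the two halves of an edge. -/
structure CMap where
  /-- the half-edges -/
  Dart : Type
  finite_dart : Finite Dart
  nonempty_dart : Nonempty Dart
  rot : Equiv.Perm Dart
  opp : Equiv.Perm Dart
  opp_opp : ∀ d, opp (opp d) = d
  opp_ne : ∀ d, opp d ≠ d
  connected : MulAction.IsPretransitive (Subgroup.closure {rot, opp}) Dart

namespace CMap

variable (M : CMap)

/-- The half-edge `d` is followed along its edge away from its vertex; at the other end the next
half-edge in clockwise order is taken. The walk keeps a face on its left, hence runs around that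
face in counterclockwise order. -/
def facePerm : Equiv.Perm M.Dart := M.rot * M.opp

/-- Vertices are the cycles of `rot`. -/
def Vertex : Type := Quotient (Equiv.Perm.SameCycle.setoid M.rot)

/-- Edges are the cycles of `opp`. -/
def Edge : Type := Quotient (Equiv.Perm.SameCycle.setoid M.opp)

/-- Faces are the cycles of `facePerm`. -/
def Face : Type := Quotient (Equiv.Perm.SameCycle.setoid M.facePerm)

variable {M}

/-- The vertex at which the half-edge `d` starts. -/
def vertex (d : M.Dart) : M.Vertex := Quotient.mk _ d

/-- The edge containing the half-edge `d`. -/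
def edge (d : M.Dart) : M.Edge := Quotient.mk _ d

/-- The face on the left of `d` (the one incident to the corner following `d` in counterclockwise
order around its vertex). The face on the right of `d` is `face (M.opp d)`. -/
def face (d : M.Dart) : M.Face := Quotient.mk _ d

/-- The degree of a face: its number of corners. -/
noncomputable def faceDegree (f : M.Face) : ℕ := Nat.card {d : M.Dart // face d = f}

/-- `u` and `v` are joined by an edge of `A`. -/
def AdjIn (A : Set M.Edge) (u v : M.Vertex) : Prop :=
  ∃ d : M.Dart, edge d ∈ A ∧ vertex d = u ∧ vertex (M.opp d) = v

/-- `A` is (the edge set of) a spanning tree: it connects all vertices, and no edge of `A` lies on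
a cycle of `A`, that is, its ends are not connected by the other edges of `A`. -/
def IsSpanningTree (A : Set M.Edge) : Prop :=
  (∀ u v : M.Vertex, Relation.ReflTransGen (AdjIn A) u v) ∧
  ∀ d : M.Dart, edge d ∈ A →
    ¬ Relation.ReflTransGen (AdjIn (A \ {edge d})) (vertex d) (vertex (M.opp d))

theorem face_eq_of_facePerm {d d' : M.Dart} (h : M.facePerm d = d') : face d = face d' :=
  Quotient.sound (s := Equiv.Perm.SameCycle.setoid M.facePerm) ⟨1, by simpa using h⟩

/-- An orientation preserving homeomorphism of maps: a bijection between the half-edges which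
respects the rotation systems and the edges. -/
structure Iso (M N : CMap) where
  toEquiv : M.Dart ≃ N.Dart
  map_rot : ∀ d, toEquiv (M.rot d) = N.rot (toEquiv d)
  map_opp : ∀ d, toEquiv (M.opp d) = N.opp (toEquiv d)

namespace Iso

def refl (M : CMap) : Iso M M := ⟨Equiv.refl _, fun _ => rfl, fun _ => rfl⟩

def symm {M N : CMap} (f : Iso M N) : Iso N M where
  toEquiv := f.toEquiv.symm
  map_rot d := by rw [Equiv.symm_apply_eq, f.map_rot, Equiv.apply_symm_apply]
  map_opp d := by rw [Equiv.symm_apply_eq, f.map_opp, Equiv.apply_symm_apply]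

def trans {M N P : CMap} (f : Iso M N) (g : Iso N P) : Iso M P where
  toEquiv := f.toEquiv.trans g.toEquiv
  map_rot d := by simp [f.map_rot, g.map_rot]
  map_opp d := by simp [f.map_opp, g.map_opp]

end Iso

end CMap

open CMap

/-- A `k`-constellation: a map with black and white faces and `k` types of vertices such that each
edge separates a black face and a white face, and each black face has degree `k` and is incident to
vertices of types `1, …, k` in clockwise order. The type `t ∈ {1, …, k}` is the element `t - 1` of
`Fin k`, and the addition of `Fin k` is modulo `k`. -/
structure Constellation (k : ℕ) [NeZero k] extends CMap where
  black : toCMap.Face → Bool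
  typ : toCMap.Vertex → Fin k
  separates : ∀ d, black (face (opp d)) = !black (face d)
  degree_black : ∀ f, black f = true → faceDegree f = k
  /- `facePerm` runs counterclockwise, so the vertex of `d` follows that of `facePerm d` in
  clockwise order around the face. -/
  typ_black : ∀ d, black (face d) = true →
    typ (vertex d) = typ (vertex (toCMap.facePerm d)) + 1

namespace Constellation

variable {k : ℕ} [NeZero k] (C : Constellation k)

/-- The hyperedges are the black faces. -/
def Hyperedge : Type := {f : C.Face // C.black f = true}

def WhiteFace : Type := {f : C.Face // C.black f = false}

/-- The size is the number of hyperedges. -/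
noncomputable def size : ℕ := Nat.card C.Hyperedge

variable {C}

/-- The half-edge `d` is the initial half of its edge, when edges are oriented so that the type of
the vertices increases by one, i.e. so that edges run clockwise around the hyperedges: there is a
white face on the left of `d`, hence a black face on its right. -/
def IsOut (d : C.Dart) : Prop := C.black (face d) = false

/-- The edge `e` has type `t`: it goes from a vertex of type `t` to a vertex of type `t + 1`
in clockwise order around the hyperedge containing it. -/
def HasType (e : C.Edge) (t : Fin k) : Prop :=
  ∃ d : C.Dart, edge d = e ∧ IsOut d ∧ C.typ (vertex d) = t

/-- The vertex `v` is an end of the edge `e`. -/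
def IsEnd (v : C.Vertex) (e : C.Edge) : Prop := ∃ d : C.Dart, edge d = e ∧ vertex d = v

/-- The spanning tree `A` is a `v₀`-arborescence: every vertex `v ≠ v₀` of type `t` is incident to
exactly one edge of type `t` in `A`. -/
def IsArborescence (v₀ : C.Vertex) (A : Set C.Edge) : Prop :=
  IsSpanningTree A ∧
  ∀ v : C.Vertex, v ≠ v₀ → ∃! e : C.Edge, e ∈ A ∧ HasType e (C.typ v) ∧ IsEnd v e

/-- The last type, i.e. type `k`. -/
def lastType (k : ℕ) [NeZero k] : Fin k := ⟨k - 1, Nat.sub_lt (NeZero.pos k) Nat.one_pos⟩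

/-- `v` is the vertex of type `k` incident to the hyperedge `h`. -/
def IsRootVertex (h : C.Hyperedge) (v : C.Vertex) : Prop :=
  C.typ v = lastType k ∧ ∃ d : C.Dart, face d = h.1 ∧ vertex d = v

/-- For an assignment `c` of a type `t` and of a colour (or label) in `[p t]` to every vertex, the
number of edges of type `t` joining a vertex of type `t` and colour `i` to a vertex of type `t + 1`
and colour `j`. -/
noncomputable def edgeCount {p : Fin k → ℕ} (c : C.Vertex → (t : Fin k) × Fin (p t))
    (t : Fin k) (i : Fin (p t)) (j : Fin (p (t + 1))) : ℕ :=
  Nat.card {e : C.Edge // ∃ d : C.Dart, edge d = e ∧ IsOut d ∧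
    c (vertex d) = ⟨t, i⟩ ∧ c (vertex (C.opp d)) = ⟨t + 1, j⟩}

/-- If there is a black face on the left of `d`, then going counterclockwise around the vertex of
`d` by two half-edges one finds the next half-edge with a black face on its left. -/
theorem black_next {d : C.Dart} (h : C.black (face d) = true) :
    C.black (face (C.rot⁻¹ (C.rot⁻¹ d))) = true := by
  have key : ∀ d : C.Dart, C.black (face (C.rot⁻¹ d)) = !C.black (face d) := by
    intro d
    have h1 : face (C.opp (C.rot⁻¹ d)) = face d :=
      face_eq_of_facePerm (by simp [facePerm, C.opp_opp])
    have h2 := C.separates (C.rot⁻¹ d)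
    rw [h1] at h2
    simp [h2]
  rw [key, key, h]
  rfl

/-- The hyperedge on the left of a half-edge. -/
def hyperedge (d : C.Dart) (h : C.black (face d) = true) : C.Hyperedge := ⟨face d, h⟩

/-- Isomorphisms of constellations: orientation preserving homeomorphisms which preserve the
colours of the faces and the types of the vertices. -/
structure Iso (C D : Constellation k) extends CMap.Iso C.toCMap D.toCMap where
  map_black : ∀ d, D.black (face (toEquiv d)) = C.black (face d)
  map_typ : ∀ d, D.typ (vertex (toEquiv d)) = C.typ (vertex d)

namespace Iso

def refl (C : Constellation k) : Iso C C :=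
  { CMap.Iso.refl C.toCMap with map_black := fun _ => rfl, map_typ := fun _ => rfl }

def symm {C D : Constellation k} (f : Iso C D) : Iso D C :=
  { f.toIso.symm with
    map_black := fun d => by
      have := f.map_black (f.toEquiv.symm d)
      rw [Equiv.apply_symm_apply] at this
      exact this.symm
    map_typ := fun d => by
      have := f.map_typ (f.toEquiv.symm d)
      rw [Equiv.apply_symm_apply] at this
      exact this.symm }

def trans {C D E : Constellation k} (f : Iso C D) (g : Iso D E) : Iso C E :=
  { f.toIso.trans g.toIso with
    map_black := fun d => (g.map_black _).trans (f.map_black d)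
    map_typ := fun d => (g.map_typ _).trans (f.map_typ d) }

end Iso

end Constellation

open Constellation

section Objects

variable {k : ℕ} [NeZero k] (n : ℕ) (p : Fin k → ℕ)

/-- A `(p₁, …, p_k)`-coloured rooted `k`-cactus of size `n`: a `k`-constellation with `n` hyperedges
and a single white face, with a distinguished hyperedge, and with colours in `[p t]` for the
vertices of each type `t`, such that all these colours are used. -/
structure CactusData extends Constellation k where
  size_eq : toConstellation.size = n
  card_white : Nat.card toConstellation.WhiteFace = 1
  root : toConstellation.Hyperedge
  color : toCMap.Vertex → (t : Fin k) × Fin (p t)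
  color_fst : ∀ v, (color v).1 = typ v
  color_surjective : Function.Surjective color

/-- A vertex-labelled tree-rooted `k`-constellation of size `n` and type `(p₁, …, p_k)`: a
`k`-constellation with `n` hyperedges, with a distinguished hyperedge, with an arborescence directed
to the root vertex, and with a bijective labelling by `[p t]` of the vertices of each type `t`. -/
structure TreeRootedData extends Constellation k where
  size_eq : toConstellation.size = n
  root : toConstellation.Hyperedge
  tree : Set toCMap.Edge
  tree_arborescence : ∃ v₀, IsRootVertex root v₀ ∧ IsArborescence v₀ tree
  label : toCMap.Vertex → (t : Fin k) × Fin (p t)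
  label_fst : ∀ v, (label v).1 = typ v
  label_bijective : Function.Bijective label

variable {n p}

/-- Coloured rooted cacti are considered up to orientation preserving homeomorphisms preserving the
whole structure. -/
instance CactusData.setoid : Setoid (CactusData n p) where
  r C D := ∃ f : Constellation.Iso C.toConstellation D.toConstellation,
    (∀ d, face (f.toEquiv d) = D.root.1 ↔ face d = C.root.1) ∧
    ∀ d, D.color (vertex (f.toEquiv d)) = C.color (vertex d)
  iseqv :=
    { refl := fun _ => ⟨Constellation.Iso.refl _, fun _ => Iff.rfl, fun _ => rfl⟩
      symm := by
        rintro C D ⟨f, h1, h2⟩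
        refine ⟨f.symm, fun d => ?_, fun d => ?_⟩
        · have := h1 (f.toEquiv.symm d)
          rw [Equiv.apply_symm_apply] at this
          exact this.symm
        · have := h2 (f.toEquiv.symm d)
          rw [Equiv.apply_symm_apply] at this
          exact this.symm
      trans := by
        rintro C D E ⟨f, h1, h2⟩ ⟨g, h3, h4⟩
        exact ⟨f.trans g, fun d => (h3 _).trans (h1 d), fun d => (h4 _).trans (h2 d)⟩ }

/-- Tree-rooted constellations are considered up to orientation preserving homeomorphisms
preserving the whole structure. -/
instance TreeRootedData.setoid : Setoid (TreeRootedData n p) where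
  r C D := ∃ f : Constellation.Iso C.toConstellation D.toConstellation,
    (∀ d, face (f.toEquiv d) = D.root.1 ↔ face d = C.root.1) ∧
    (∀ d, edge (f.toEquiv d) ∈ D.tree ↔ edge d ∈ C.tree) ∧
    ∀ d, D.label (vertex (f.toEquiv d)) = C.label (vertex d)
  iseqv :=
    { refl := fun _ => ⟨Constellation.Iso.refl _, fun _ => Iff.rfl, fun _ => Iff.rfl, fun _ => rfl⟩
      symm := by
        rintro C D ⟨f, h1, h2, h3⟩
        refine ⟨f.symm, fun d => ?_, fun d => ?_, fun d => ?_⟩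
        · have := h1 (f.toEquiv.symm d)
          rw [Equiv.apply_symm_apply] at this
          exact this.symm
        · have := h2 (f.toEquiv.symm d)
          rw [Equiv.apply_symm_apply] at this
          exact this.symm
        · have := h3 (f.toEquiv.symm d)
          rw [Equiv.apply_symm_apply] at this
          exact this.symm
      trans := by
        rintro C D E ⟨f, h1, h2, h3⟩ ⟨g, h4, h5, h6⟩
        exact ⟨f.trans g, fun d => (h4 _).trans (h1 d), fun d => (h5 _).trans (h2 d),
          fun d => (h6 _).trans (h3 d)⟩ }

variable (n p)

/-- The set of `(p₁, …, p_k)`-coloured rooted `k`-cacti of size `n`. -/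
def ColoredRootedCacti : Type 1 := Quotient (CactusData.setoid (n := n) (p := p))

/-- The set of vertex-labelled tree-rooted `k`-constellations of size `n` and type
`(p₁, …, p_k)`. -/
def TreeRootedConstellations : Type 1 := Quotient (TreeRootedData.setoid (n := n) (p := p))

variable {n p}

/-- The coloured rooted cactus with underlying data `C`. -/
def CactusData.toClass (C : CactusData n p) : ColoredRootedCacti n p := Quotient.mk _ C

/-- The tree-rooted constellation with underlying data `T`. -/
def TreeRootedData.toClass (T : TreeRootedData n p) : TreeRootedConstellations n p :=
  Quotient.mk _ T

variable (n p)

/-- A `(p₁, …, p_k)`-coloured factorization of `(1, 2, …, n)`; the set `[n]` is `Fin n`, and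
`finRotate n` is its long cycle `a ↦ a + 1`. -/
structure ColoredFactorization where
  perm : Fin k → Equiv.Perm (Fin n)
  prod_eq : (List.ofFn perm).prod = finRotate n
  color : (t : Fin k) → Fin n → Fin (p t)
  color_surjective : ∀ t, Function.Surjective (color t)
  color_eq : ∀ t a b, (perm t).SameCycle a b → color t a = color t b

variable {n p}

/-- The coloured rooted cactus `C` encodes the coloured factorization `F`: for some labelling of the
hyperedges by `[n]` in which the root hyperedge gets the first label, the counterclockwise order of
the hyperedges around the vertices of type `t` is given by the cycles of the `t`-th factor, and the
colour of a vertex of type `t` is the colour of the corresponding cycle. -/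
def CactusData.Encodes (C : CactusData n p) (F : ColoredFactorization n p) : Prop :=
  ∃ l : C.Hyperedge ≃ Fin n, (l C.root).val = 0 ∧
    ∀ (d : C.Dart) (h : C.black (face d) = true),
      F.perm (C.typ (vertex d)) (l (hyperedge d h)) =
        l (hyperedge (C.rot⁻¹ (C.rot⁻¹ d)) (black_next h)) ∧
      C.color (vertex d) = ⟨C.typ (vertex d), F.color (C.typ (vertex d)) (l (hyperedge d h))⟩

end Objects

end TreeRooted

namespace TreeRooted

open CMap Constellation

/-! Number the hyperedges by `Fin n`. A constellation becomes a tuple of permutations `π t`, the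
counterclockwise orders of the hyperedges around the vertices of type `t`; a colouring or labelling
becomes a family of maps `φ t : Fin n → Fin (p t)`; isomorphism becomes simultaneous relabelling.
The edges are the pairs `(a, t)`. The maps `φ` alone determine a directed multigraph `G` on the set
of all colours, where `(a, t)` goes from the colour of `(a, t)` to that of `(a, t + 1)`. Each edge
has a successor around its hyperedge and this is a bijection, so `G` has equal in- and outdegrees.

Walking along white faces sends `(a, t)` to `((π (t + 1))⁻¹ a, t + 1)`. For a coloured cactus this
is a single cycle, hence an Eulerian tour of `G`, and every Eulerian tour of `G` comes from exactly
one tuple `π` (`exists_tourPerm_eq_of_isTour`). For a labelled tree-rooted constellation the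
vertices are those of `G`, the tuple is a cyclic order on the edges leaving each vertex, and the
arborescence is a spanning tree directed to the root vertex (`isArborescence_iff`).

So (b) is the bijection of the BEST theorem: a tour starting at the edge `e₀` of type `k` of the
root hyperedge is sent to the order of exits at each vertex, made cyclic, together with the tree of
last exits from the vertices other than the origin of `e₀`. Both sides are encoded by the same rank
function, the number of earlier exits from the same vertex. A tour yields a tree because last exits
followed one after another occur later and later; a rotation with a tree yields a tour because the
greedy walk obeying the ranks can only stop at the root after using every edge. The carrying lemmas
are `exists_rotation_of_tour`, `exists_tour_of_rotation` and the uniqueness statements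
`BestRel.unique_rotation` and `BestRel.unique_tour`. Edge counts depend only on `φ`, which is kept
fixed, so the bijection preserves degrees.

For (a), the first return of the white tour to the edges of type `k` is the inverse of `π₁ ∘ ⋯ ∘
π_k`. Hence there is one white face exactly when this product is an `n`-cycle, and requiring it to
be `finRotate n` with the root labelled `0` leaves exactly one labelling. -/

theorem apply_inv_apply {α : Type*} (f : Equiv.Perm α) (a : α) : f (f⁻¹ a) = a :=
  f.apply_symm_apply a

theorem inv_apply_apply {α : Type*} (f : Equiv.Perm α) (a : α) : f⁻¹ (f a) = a :=
  f.symm_apply_apply a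

/-! ### Eulerian tours, rotations with trees, and exit ranks -/

section EulerTours

set_option linter.unusedSectionVars false

variable {E V : Type*} [Fintype E] [DecidableEq V]

/-- The orbit of `a` is everything, so its minimal period is the cardinality. -/
theorem bijective_pow_apply {α : Type*} [Fintype α] {f : Equiv.Perm α} {a : α}
    (h : ∀ b, f.SameCycle a b) :
    Function.Bijective (fun i : Fin (Fintype.card α) => (f ^ (i : ℕ)) a) := by
  have hper : a ∈ Function.periodicPts f := by
    obtain ⟨m, hm, hm'⟩ := isOfFinOrder_iff_pow_eq_one.1 (isOfFinOrder_of_finite f)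
    refine ⟨m, hm, ?_⟩
    rw [Function.IsPeriodicPt, Equiv.Perm.iterate_eq_pow, hm']
    rfl
  have hpos : 0 < Function.minimalPeriod f a := Function.minimalPeriod_pos_of_mem_periodicPts hper
  have hbij : Function.Bijective
      (fun i : Fin (Function.minimalPeriod f a) => (f ^ (i : ℕ)) a) := by
    refine ⟨fun i j hij => ?_, fun b => ?_⟩
    · apply Fin.ext
      apply Function.iterate_injOn_Iio_minimalPeriod (f := f) (x := a) i.2 j.2
      simpa [Equiv.Perm.iterate_eq_pow] using hij
    · obtain ⟨i, hi⟩ := (h b).exists_nat_pow_eq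
      refine ⟨⟨i % Function.minimalPeriod f a, Nat.mod_lt _ hpos⟩, ?_⟩
      have := Function.iterate_mod_minimalPeriod_eq (f := f) (x := a) (n := i)
      simp only [Equiv.Perm.iterate_eq_pow] at this
      exact this.trans hi
  have hcard : Function.minimalPeriod f a = Fintype.card α := by
    simpa using Fintype.card_of_bijective hbij
  rw [hcard] at hbij
  exact hbij

theorem pow_card_apply {α : Type*} [Fintype α] {f : Equiv.Perm α} {a : α}
    (h : ∀ b, f.SameCycle a b) : (f ^ Fintype.card α) a = a := by
  have hbij := bijective_pow_apply h
  obtain ⟨⟨i, hi⟩, hia⟩ := hbij.2 ((f ^ Fintype.card α) a)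
  simp only at hia
  obtain ⟨m, hm⟩ : ∃ m, Fintype.card α = m + 1 := ⟨Fintype.card α - 1, by omega⟩
  cases i with
  | zero => exact hia.symm
  | succ i =>
    rw [hm, pow_succ', pow_succ', Equiv.Perm.mul_apply, Equiv.Perm.mul_apply] at hia
    have := hbij.1 (a₁ := ⟨i, by omega⟩) (a₂ := ⟨m, by omega⟩) (f.injective hia)
    rw [Fin.mk.injEq] at this
    omega

/-- The number of edges starting at `v`. -/
def outDegree (src : E → V) (v : V) : ℕ := (Finset.univ.filter (fun e => src e = v)).card

/-- `r` numbers the edges starting at each vertex `v` from `0` to `outDegree src v - 1`. -/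
structure IsExitRank (src : E → V) (r : E → ℕ) : Prop where
  inj : ∀ e f, src e = src f → r e = r f → e = f
  lt : ∀ e, r e < outDegree src (src e)

/-- The vertex `w` can be reached from `u` along an edge of `A`, where the edge `e` goes from
`src e` to `src (β e)`. -/
def StepIn (src : E → V) (β : E → E) (A : Set E) (u w : V) : Prop :=
  ∃ e ∈ A, src e = u ∧ src (β e) = w

/-- `A` is a spanning tree in which all edges are directed to `v₀`. -/
structure IsOutTree (src : E → V) (β : E → E) (v₀ : V) (A : Set E) : Prop where
  exists_mem : ∀ v, v ≠ v₀ → ∃ e ∈ A, src e = v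
  unique : ∀ e ∈ A, ∀ f ∈ A, src e = src f → e = f
  ne_root : ∀ e ∈ A, src e ≠ v₀
  reach : ∀ v, Relation.ReflTransGen (StepIn src β A) v v₀

/-- `τ` sends each edge of an Eulerian tour to the next one. -/
structure IsTour (src : E → V) (β : E → E) (τ : Equiv.Perm E) : Prop where
  src_apply : ∀ e, src (τ e) = src (β e)
  sameCycle : ∀ e f, τ.SameCycle e f

/-- The last exits from the vertices different from `v₀`. -/
def lastExits (src : E → V) (v₀ : V) (r : E → ℕ) : Set E :=
  {e | src e ≠ v₀ ∧ r e + 1 = outDegree src (src e)}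

/-- In the tour starting with `e₀`, the edge `e` is preceded by `r e` edges with the same origin. -/
def IsTourRank (src : E → V) (e₀ : E) (τ : Equiv.Perm E) (r : E → ℕ) : Prop :=
  ∀ i < Fintype.card E, r ((τ ^ i) e₀) =
    ((Finset.range i).filter (fun j => src ((τ ^ j) e₀) = src ((τ ^ i) e₀))).card

/-- The cycles of `σ` are the sets of edges with a given origin. -/
def IsRotation (src : E → V) (σ : Equiv.Perm E) : Prop :=
  ∀ e f, σ.SameCycle e f ↔ src e = src f

/-- `r` numbers the edges around each vertex in the order given by `σ`, ending at the edge of `A`,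
or just before `e₀`. -/
def IsRotRank (e₀ : E) (σ : Equiv.Perm E) (A : Set E) (r : E → ℕ) : Prop :=
  ∀ e, (e ∈ A ∨ σ e = e₀ → r (σ e) = 0) ∧ (¬ (e ∈ A ∨ σ e = e₀) → r (σ e) = r e + 1)

/-- The tour `τ` starting with `e₀` leaves each vertex in the order given by the rotation `σ`, the
last exits being the edges of `A`. -/
def BestRel (src : E → V) (e₀ : E) (τ σ : Equiv.Perm E) (A : Set E) : Prop :=
  ∃ r, IsTourRank src e₀ τ r ∧ IsRotRank e₀ σ A r

/-- Pigeonhole: the ranks at `v` are distinct and bounded by the number of edges at `v`. -/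
theorem IsExitRank.exists_rank {src : E → V} {r : E → ℕ} (h : IsExitRank src r) {v : V} {i : ℕ}
    (hi : i < outDegree src v) : ∃ e, src e = v ∧ r e = i := by
  have himg : (Finset.univ.filter (fun e => src e = v)).image r
      = Finset.range (outDegree src v) := by
    apply Finset.eq_of_subset_of_card_le
    · intro j hj
      simp only [Finset.mem_image, Finset.mem_filter, Finset.mem_univ, true_and] at hj
      obtain ⟨e, rfl, rfl⟩ := hj
      exact Finset.mem_range.2 (h.lt e)
    · rw [Finset.card_image_of_injOn, Finset.card_range]
      · rfl
      · intro e he f hf hef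
        simp only [Finset.coe_filter, Finset.mem_univ, true_and, Set.mem_ofPred_eq] at he hf
        exact h.inj e f (he.trans hf.symm) hef
  have := Finset.mem_range.2 hi
  rw [← himg] at this
  simpa using this

theorem outDegree_pos (src : E → V) (e : E) : 0 < outDegree src (src e) :=
  Finset.card_pos.2 ⟨e, by simp⟩

/-! ### Rotations and exit ranks -/

section Rotation

variable {src : E → V} {β : E → E} {e₀ : E} {σ σ' : Equiv.Perm E} {A A' : Set E} {r r' : E → ℕ}

theorem IsRotation.src_apply (hσ : IsRotation src σ) (e : E) : src (σ e) = src e :=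
  ((hσ _ _).1 (Equiv.Perm.sameCycle_apply_left.2 (Equiv.Perm.SameCycle.refl σ e)))

theorem IsRotation.src_symm_apply (hσ : IsRotation src σ) (e : E) : src (σ⁻¹ e) = src e := by
  simpa using (hσ.src_apply (σ⁻¹ e)).symm

theorem IsRotation.src_inv_pow_apply (hσ : IsRotation src σ) (e : E) (i : ℕ) :
    src ((σ⁻¹ ^ i) e) = src e := by
  induction i with
  | zero => rfl
  | succ i ih => rw [pow_succ', Equiv.Perm.mul_apply, hσ.src_symm_apply, ih]

/-- Call an edge last if it lies in `A` or immediately precedes `e₀` in the rotation. The tree has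
one edge out of each vertex except the root vertex, where it has none and the predecessor of `e₀`
takes over; so each vertex has one last edge. -/
theorem last_unique (hσ : IsRotation src σ) (hA : IsOutTree src β (src e₀) A) {e f : E}
    (he : e ∈ A ∨ σ e = e₀) (hf : f ∈ A ∨ σ f = e₀) (h : src e = src f) : e = f := by
  rcases he with he | he <;> rcases hf with hf | hf
  · exact hA.unique e he f hf h
  · exact absurd (by rw [h, ← hf, hσ.src_apply]) (hA.ne_root e he)
  · exact absurd (by rw [← h, ← he, hσ.src_apply]) (hA.ne_root f hf)
  · exact σ.injective (he.trans hf.symm)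

theorem exists_last (hσ : IsRotation src σ) (hA : IsOutTree src β (src e₀) A) (e : E) :
    ∃ l, src l = src e ∧ (l ∈ A ∨ σ l = e₀) := by
  by_cases h : src e = src e₀
  · exact ⟨σ⁻¹ e₀, by rw [hσ.src_symm_apply, h], Or.inr (by simp)⟩
  · obtain ⟨l, hl, hle⟩ := hA.exists_mem _ h
    exact ⟨l, hle, Or.inl hl⟩

theorem exists_isRotRank (hσ : IsRotation src σ) (hA : IsOutTree src β (src e₀) A) :
    ∃ r, IsRotRank e₀ σ A r := by
  classical
  -- The rank of `e` will be the number of edges strictly between the preceding last edge and `e`,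
  -- found by walking back along `σ`.
  set P : E → ℕ → Prop := fun e i => (σ⁻¹ ^ (i + 1)) e ∈ A ∨ σ ((σ⁻¹ ^ (i + 1)) e) = e₀ with hP
  have hex : ∀ e, ∃ i, P e i := by
    intro e
    obtain ⟨l, hl, hl'⟩ := exists_last hσ hA e
    have hs : (σ⁻¹).SameCycle (σ⁻¹ e) l := by
      rw [Equiv.Perm.sameCycle_inv, hσ, hσ.src_symm_apply, hl]
    obtain ⟨i, hi⟩ := hs.exists_nat_pow_eq
    refine ⟨i, ?_⟩
    simp only [hP, pow_succ, Equiv.Perm.mul_apply, hi]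
    exact hl'
  refine ⟨fun e => Nat.find (hex e), fun e => ⟨fun h => ?_, fun h => ?_⟩⟩
  · simp only [Nat.find_eq_zero, hP]
    simpa using h
  · rw [Nat.find_eq_iff]
    have hs : ∀ i, P (σ e) (i + 1) ↔ P e i := by
      intro i
      simp only [hP]
      rw [pow_succ _ (i + 1), Equiv.Perm.mul_apply, inv_apply_apply]
    refine ⟨(hs _).2 (Nat.find_spec (hex e)), fun i hi => ?_⟩
    cases i with
    | zero => simpa [hP] using h
    | succ i => rw [hs]; exact Nat.find_min (hex e) (Nat.lt_of_succ_lt_succ hi)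

/-- Ranks count from the last edge, so `r e + 1` steps back from `e` return to it. Since the last
edge of a vertex is unique, an edge is recovered from its origin and its rank. -/
theorem IsRotRank.last_pow (h : IsRotRank e₀ σ A r) (e : E) :
    (σ⁻¹ ^ (r e + 1)) e ∈ A ∨ σ ((σ⁻¹ ^ (r e + 1)) e) = e₀ := by
  induction hn : r e generalizing e with
  | zero =>
    by_contra hc
    have := (h (σ⁻¹ e)).2 (by simpa using hc)
    simp at this
    omega
  | succ m ih =>
    by_cases hc : σ⁻¹ e ∈ A ∨ σ (σ⁻¹ e) = e₀
    · have := (h _).1 hc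
      simp at this
      omega
    · have := (h _).2 hc
      rw [apply_inv_apply] at this
      have := ih (σ⁻¹ e) (by omega)
      rwa [pow_succ, Equiv.Perm.mul_apply]

theorem IsRotRank.inj (hσ : IsRotation src σ) (hA : IsOutTree src β (src e₀) A)
    (h : IsRotRank e₀ σ A r) (e f : E) (hs : src e = src f) (hr : r e = r f) : e = f := by
  have h1 := h.last_pow e
  have h2 := h.last_pow f
  rw [← hr] at h2
  exact (σ⁻¹ ^ (r e + 1)).injective (last_unique hσ hA h1 h2
    (by rw [hσ.src_inv_pow_apply, hσ.src_inv_pow_apply, hs]))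

/-- Stepping back along `σ` lowers a positive rank by one, so the ranks at a vertex form an initial
segment; with injectivity this bounds them by the outdegree. -/
theorem IsRotRank.exists_smaller (hσ : IsRotation src σ) (h : IsRotRank e₀ σ A r) (e : E) {i : ℕ}
    (hi : i ≤ r e) : ∃ f, src f = src e ∧ r f = i := by
  induction hn : r e - i generalizing e with
  | zero => exact ⟨e, rfl, by omega⟩
  | succ m ih =>
    have hc : ¬ (σ⁻¹ e ∈ A ∨ σ (σ⁻¹ e) = e₀) := by
      intro hc
      have := (h _).1 hc
      rw [apply_inv_apply] at this
      omega
    have := (h _).2 hc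
    rw [apply_inv_apply] at this
    obtain ⟨f, hf, hf'⟩ := ih (σ⁻¹ e) (by omega) (by omega)
    exact ⟨f, hf.trans (hσ.src_symm_apply e), hf'⟩

theorem IsRotRank.isExitRank (hσ : IsRotation src σ) (hA : IsOutTree src β (src e₀) A)
    (h : IsRotRank e₀ σ A r) : IsExitRank src r where
  inj := h.inj hσ hA
  lt e := by
    have hsub : Finset.range (r e + 1) ⊆ (Finset.univ.filter (fun f => src f = src e)).image r := by
      intro i hi
      obtain ⟨f, hf, hf'⟩ := h.exists_smaller hσ e (Nat.lt_succ_iff.1 (Finset.mem_range.1 hi))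
      exact Finset.mem_image.2 ⟨f, by simpa using hf, hf'⟩
    have := (Finset.card_le_card hsub).trans Finset.card_image_le
    rw [Finset.card_range] at this
    exact this

theorem IsRotRank.last_iff (hσ : IsRotation src σ) (hA : IsOutTree src β (src e₀) A)
    (h : IsRotRank e₀ σ A r) (e : E) :
    (e ∈ A ∨ σ e = e₀) ↔ r e + 1 = outDegree src (src e) := by
  have key : ∀ e, (e ∈ A ∨ σ e = e₀) → r e + 1 = outDegree src (src e) := by
    intro e he
    apply le_antisymm ((h.isExitRank hσ hA).lt e)
    by_contra! hlt
    obtain ⟨f, hf, hf'⟩ := (h.isExitRank hσ hA).exists_rank hlt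
    -- Starting from a last edge `e`, ranks along `σ` can pass `r e` only right after an edge of
    -- rank `r e`. By injectivity that edge is `e`, after which the rank drops to `0`.
    have hle : ∀ j : ℕ, r ((σ ^ j) e) ≤ r e := by
      intro j
      induction j with
      | zero => rfl
      | succ j ih =>
        rw [pow_succ', Equiv.Perm.mul_apply]
        by_cases hc : (σ ^ j) e ∈ A ∨ σ ((σ ^ j) e) = e₀
        · rw [(h _).1 hc]; exact Nat.zero_le _
        · rw [(h _).2 hc]
          refine Nat.lt_of_le_of_ne ih fun heq => hc ?_
          have hsrc : src ((σ ^ j) e) = src e :=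
            ((hσ _ _).1 ⟨j, by simp⟩).symm
          rwa [h.inj hσ hA _ _ hsrc heq]
    obtain ⟨j, hj⟩ := ((hσ e f).2 hf.symm).exists_nat_pow_eq
    have := hle j
    rw [hj] at this
    omega
  refine ⟨key e, fun he => ?_⟩
  obtain ⟨l, hl, hl'⟩ := exists_last hσ hA e
  have h1 := key l hl'
  rw [hl] at h1
  rwa [← h.inj hσ hA l e hl (by omega)]

theorem IsRotRank.eq_lastExits (hσ : IsRotation src σ) (hA : IsOutTree src β (src e₀) A)
    (h : IsRotRank e₀ σ A r) : A = lastExits src (src e₀) r := by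
  ext e
  refine ⟨fun he => ⟨hA.ne_root e he, (h.last_iff hσ hA e).1 (Or.inl he)⟩, fun he => ?_⟩
  refine ((h.last_iff hσ hA e).2 he.2).resolve_right fun h0 => he.1 ?_
  rw [← h0, hσ.src_apply]

theorem IsRotRank.zero (h : IsRotRank e₀ σ A r) : r e₀ = 0 := by
  simpa using (h (σ⁻¹ e₀)).1 (Or.inr (by simp))

/-- Induction on the rank: edges following a last edge have rank `0`, and all other ranks come from
the predecessor. -/
theorem IsRotRank.unique_rank (h : IsRotRank e₀ σ A r) (h' : IsRotRank e₀ σ A r') : r = r' := by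
  funext e
  induction hn : r e generalizing e with
  | zero =>
    by_cases hc : σ⁻¹ e ∈ A ∨ σ (σ⁻¹ e) = e₀
    · have := (h' _).1 hc
      simp at this
      omega
    · have := (h _).2 hc
      rw [apply_inv_apply] at this
      omega
  | succ m ih =>
    have hc : ¬ (σ⁻¹ e ∈ A ∨ σ (σ⁻¹ e) = e₀) := by
      intro hc
      have := (h _).1 hc
      rw [apply_inv_apply] at this
      omega
    have h1 := (h _).2 hc
    have h2 := (h' _).2 hc
    rw [apply_inv_apply] at h1 h2
    rw [h2, ← ih (σ⁻¹ e) (by omega)]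

theorem IsRotRank.unique_rotation (hσ : IsRotation src σ) (hA : IsOutTree src β (src e₀) A)
    (h : IsRotRank e₀ σ A r) (hσ' : IsRotation src σ') (hA' : IsOutTree src β (src e₀) A')
    (h' : IsRotRank e₀ σ' A' r) : σ = σ' ∧ A = A' := by
  refine ⟨Equiv.ext fun e => ?_, (h.eq_lastExits hσ hA).trans (h'.eq_lastExits hσ' hA').symm⟩
  apply h.inj hσ hA _ _ (by rw [hσ.src_apply, hσ'.src_apply])
  by_cases hc : r e + 1 = outDegree src (src e)
  · rw [(h e).1 ((h.last_iff hσ hA e).2 hc), (h' e).1 ((h'.last_iff hσ' hA' e).2 hc)]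
  · rw [(h e).2 (mt (h.last_iff hσ hA e).1 hc), (h' e).2 (mt (h'.last_iff hσ' hA' e).1 hc)]

/-- The rotation sends an edge to the one with the next rank at the same vertex, cyclically. The
condition `r e₀ = 0` makes the wrap-around at the root vertex happen at `e₀`. -/
theorem exists_rotation (h : IsExitRank src r) (h0 : r e₀ = 0) :
    ∃ σ, IsRotation src σ ∧ IsRotRank e₀ σ (lastExits src (src e₀) r) r := by
  classical
  have hex : ∀ e, ∃ f, src f = src e ∧
      r f = if r e + 1 = outDegree src (src e) then 0 else r e + 1 := by
    intro e
    apply h.exists_rank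
    have h1 := h.lt e
    split_ifs <;> omega
  choose s hs hr using hex
  have hinj : Function.Injective s := by
    intro e f hef
    have hsrc : src e = src f := by rw [← hs e, ← hs f, hef]
    apply h.inj _ _ hsrc
    have h1 := hr e
    have h2 := hr f
    rw [hef, h2, hsrc] at h1
    have h3 := h.lt e
    have h4 := h.lt f
    split_ifs at h1 <;> omega
  let σ : Equiv.Perm E := Equiv.ofBijective s (Finite.injective_iff_bijective.1 hinj)
  have hσe : ∀ e, σ e = s e := fun e => rfl
  have hback : ∀ e z : E, src z = src e → r z = 0 → σ.SameCycle z e := by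
    intro e z hz hz0
    induction hn : r e generalizing e with
    | zero => rw [h.inj z e hz (by omega)]
    | succ m ih =>
      have h1 := h.lt e
      obtain ⟨f, hf, hf'⟩ := h.exists_rank (v := src e) (i := m) (by omega)
      have : σ f = e := by
        apply h.inj _ _ ((hs f).trans hf)
        rw [hr, hf, if_neg (by omega)]
        omega
      rw [← this, Equiv.Perm.sameCycle_apply_right]
      exact ih f (hz.trans hf.symm) hf'
  refine ⟨σ, fun e f => ⟨?_, fun hef => ?_⟩, fun e => ?_⟩
  · intro hc
    obtain ⟨i, rfl⟩ := hc.exists_nat_pow_eq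
    induction i with
    | zero => rfl
    | succ i ih =>
      rw [pow_succ', Equiv.Perm.mul_apply, hσe, hs]
      exact ih ⟨i, by simp⟩
  · obtain ⟨z, hz, hz0⟩ := h.exists_rank (outDegree_pos src e)
    exact (hback e z hz hz0).symm.trans (hback f z (hz.trans hef) hz0)
  · have hlast : (e ∈ lastExits src (src e₀) r ∨ σ e = e₀) ↔ r e + 1 = outDegree src (src e) := by
      constructor
      · rintro (he | he)
        · exact he.2
        · by_contra hc
          have := hr e
          rw [if_neg hc, ← hσe, he] at this
          omega
      · intro he
        by_cases hv : src e = src e₀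
        · right
          apply h.inj _ _ ((hs e).trans hv)
          rw [hr, if_pos he, h0]
        · exact Or.inl ⟨hv, he⟩
    rw [hlast, hσe, hr]
    exact ⟨fun he => if_pos he, fun he => if_neg he⟩

end Rotation

/-! ### Tours and exit ranks -/

section Tour

variable {src : E → V} {β : E → E} {e₀ : E} {τ τ' : Equiv.Perm E} {r r' : E → ℕ}

theorem IsTour.exists_pow (hτ : IsTour src β τ) (e₀ e : E) :
    ∃ i < Fintype.card E, (τ ^ i) e₀ = e := by
  obtain ⟨i, hi⟩ := (bijective_pow_apply (hτ.sameCycle e₀)).2 e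
  exact ⟨i, i.2, hi⟩

theorem IsTour.pow_inj (hτ : IsTour src β τ) (e₀ : E) {i j : ℕ} (hi : i < Fintype.card E)
    (hj : j < Fintype.card E) (h : (τ ^ i) e₀ = (τ ^ j) e₀) : i = j := by
  have := (bijective_pow_apply (hτ.sameCycle e₀)).1 (a₁ := ⟨i, hi⟩) (a₂ := ⟨j, hj⟩) h
  simpa using this

theorem IsTour.pow_card (hτ : IsTour src β τ) (e₀ : E) : (τ ^ Fintype.card E) e₀ = e₀ :=
  pow_card_apply (hτ.sameCycle e₀)

theorem exists_isTourRank (hτ : IsTour src β τ) (e₀ : E) : ∃ r, IsTourRank src e₀ τ r := by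
  choose pos hpos hpos' using hτ.exists_pow e₀
  refine ⟨fun e => ((Finset.range (pos e)).filter (fun j => src ((τ ^ j) e₀) = src e)).card,
    fun i hi => ?_⟩
  have : pos ((τ ^ i) e₀) = i := hτ.pow_inj e₀ (hpos _) hi (hpos' _)
  simp only [this]

theorem IsTourRank.unique_rank (hτ : IsTour src β τ) (h : IsTourRank src e₀ τ r)
    (h' : IsTourRank src e₀ τ r') : r = r' := by
  funext e
  obtain ⟨i, hi, rfl⟩ := hτ.exists_pow e₀ e
  rw [h i hi, h' i hi]

theorem IsTourRank.zero (h : IsTourRank src e₀ τ r) : r e₀ = 0 := by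
  simpa using h 0 (Fintype.card_pos_iff.2 ⟨e₀⟩)

/-- The later edge counts everything that the earlier one counts, and the earlier edge itself. -/
theorem IsTourRank.lt_of_lt (h : IsTourRank src e₀ τ r) {i j : ℕ} (hij : i < j)
    (hj : j < Fintype.card E) (hs : src ((τ ^ i) e₀) = src ((τ ^ j) e₀)) :
    r ((τ ^ i) e₀) < r ((τ ^ j) e₀) := by
  rw [h i (hij.trans hj), h j hj]
  apply Finset.card_lt_card
  rw [Finset.ssubset_iff_of_subset]
  · exact ⟨i, by simp [hij, hs], by simp⟩
  · intro l hl
    simp only [Finset.mem_filter, Finset.mem_range] at hl ⊢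
    exact ⟨hl.1.trans hij, hl.2.trans hs⟩

theorem IsTourRank.isExitRank (hτ : IsTour src β τ) (h : IsTourRank src e₀ τ r) :
    IsExitRank src r where
  inj e f hs hr := by
    obtain ⟨i, hi, rfl⟩ := hτ.exists_pow e₀ e
    obtain ⟨j, hj, rfl⟩ := hτ.exists_pow e₀ f
    rcases lt_trichotomy i j with hij | rfl | hij
    · exact absurd hr (h.lt_of_lt hij hj hs).ne
    · rfl
    · exact absurd hr (h.lt_of_lt hij hi hs.symm).ne'
  lt e := by
    classical
    obtain ⟨i, hi, rfl⟩ := hτ.exists_pow e₀ e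
    rw [h i hi, outDegree]
    have hinj : Set.InjOn (fun j => (τ ^ j) e₀)
        ((Finset.range i).filter (fun j => src ((τ ^ j) e₀) = src ((τ ^ i) e₀))) := by
      intro a ha b hb hab
      simp only [Finset.coe_filter, Finset.mem_range, Set.mem_ofPred_eq] at ha hb
      exact hτ.pow_inj e₀ (by omega) (by omega) hab
    rw [← Finset.card_image_of_injOn hinj]
    apply Finset.card_lt_card
    rw [Finset.ssubset_iff_of_subset]
    · refine ⟨(τ ^ i) e₀, by simp, ?_⟩
      simp only [Finset.mem_image, Finset.mem_filter, Finset.mem_range, not_exists, not_and]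
      intro j hj hji
      have := hτ.pow_inj e₀ (by omega) hi hji
      omega
    · intro f hf
      simp only [Finset.mem_image, Finset.mem_filter, Finset.mem_range] at hf
      obtain ⟨j, hj, rfl⟩ := hf
      simpa using hj.2

/-- Follow a last exit from a vertex other than the root vertex: the tour immediately leaves the
vertex it enters, or has come back to its start. So the last exit from the next vertex is strictly
later, and the process must end at the root vertex. -/
theorem isOutTree_lastExits (hsrc : Function.Surjective src) (hτ : IsTour src β τ)
    (h : IsTourRank src e₀ τ r) : IsOutTree src β (src e₀) (lastExits src (src e₀) r) := by
  have hr := h.isExitRank hτ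
  have hlast : ∀ v, ∃ e, src e = v ∧ r e + 1 = outDegree src v := by
    intro v
    obtain ⟨e, rfl⟩ := hsrc v
    have := outDegree_pos src e
    obtain ⟨f, hf, hf'⟩ := hr.exists_rank (v := src e) (i := outDegree src (src e) - 1) (by omega)
    exact ⟨f, hf, by omega⟩
  refine ⟨fun v hv => ?_, fun e he f hf hef => ?_, fun e he => he.1, fun v => ?_⟩
  · obtain ⟨e, rfl, he⟩ := hlast v
    exact ⟨e, ⟨hv, he⟩, rfl⟩
  · apply hr.inj e f hef
    have h1 := he.2
    have h2 := hf.2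
    rw [hef] at h1
    omega
  · obtain ⟨e, rfl, he⟩ := hlast v
    obtain ⟨i, hi, rfl⟩ := hτ.exists_pow e₀ e
    induction hn : Fintype.card E - i using Nat.strong_induction_on generalizing i with
    | _ m ih =>
      by_cases hv : src ((τ ^ i) e₀) = src e₀
      · rw [hv]
      · refine Relation.ReflTransGen.head ⟨_, ⟨hv, he⟩, rfl, rfl⟩ ?_
        rw [← hτ.src_apply, ← Equiv.Perm.mul_apply, ← pow_succ']
        rcases Nat.lt_or_ge (i + 1) (Fintype.card E) with hlt | hge
        · obtain ⟨f, hf, hf'⟩ := hlast (src ((τ ^ (i + 1)) e₀))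
          obtain ⟨j, hj, rfl⟩ := hτ.exists_pow e₀ f
          -- The tour leaves this vertex at time `i + 1`, so its last exit is not earlier.
          have hij : i + 1 ≤ j := by
            by_contra! hlt'
            have h1 := h.lt_of_lt hlt' hlt hf
            have h2 := hr.lt ((τ ^ (i + 1)) e₀)
            omega
          rw [← hf] at hf' ⊢
          exact ih _ (by omega) j hj hf' rfl
        · rw [show i + 1 = Fintype.card E by omega, hτ.pow_card]

/-- The edges used so far determine the current vertex and the number of its previous exits; the
rank function then names the next edge. -/
theorem IsTourRank.unique_tour (hτ : IsTour src β τ) (h : IsTourRank src e₀ τ r)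
    (hτ' : IsTour src β τ') (h' : IsTourRank src e₀ τ' r) : τ = τ' := by
  have key : ∀ i < Fintype.card E, (τ ^ i) e₀ = (τ' ^ i) e₀ := by
    intro i
    induction i using Nat.strong_induction_on with
    | _ i ih =>
      intro hi
      cases i with
      | zero => rfl
      | succ i =>
        have hs : src ((τ ^ (i + 1)) e₀) = src ((τ' ^ (i + 1)) e₀) := by
          rw [pow_succ', pow_succ', Equiv.Perm.mul_apply, Equiv.Perm.mul_apply, hτ.src_apply,
            hτ'.src_apply, ih i (by omega) (by omega)]
        apply (h.isExitRank hτ).inj _ _ hs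
        rw [h _ hi, h' _ hi, ← hs]
        congr 1
        apply Finset.filter_congr
        intro j hj
        rw [ih j (Finset.mem_range.1 hj) ((Finset.mem_range.1 hj).trans hi)]
  ext e
  obtain ⟨i, hi, rfl⟩ := hτ.exists_pow e₀ e
  rw [← Equiv.Perm.mul_apply, ← pow_succ', key i hi, ← Equiv.Perm.mul_apply, ← pow_succ']
  rcases Nat.lt_or_ge (i + 1) (Fintype.card E) with hlt | hge
  · exact key _ hlt
  · rw [show i + 1 = Fintype.card E by omega, hτ.pow_card, hτ'.pow_card]

end Tour

end EulerTours

section EulerTours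

set_option linter.unusedSectionVars false

variable {E V : Type*} [Fintype E] [DecidableEq V]

/-! ### From ranks to tours: the greedy walk -/

section Walk

variable {src : E → V} {β : E → E} {e₀ : E} {r : E → ℕ} {w : ℕ → E} {m : ℕ}

/-- The first `m` edges of `w` form a walk starting with `e₀` which uses the edges starting at each
vertex in the order of their ranks. -/
structure IsWalk (src : E → V) (β : E → E) (e₀ : E) (r : E → ℕ) (w : ℕ → E) (m : ℕ) : Prop where
  zero : w 0 = e₀
  succ : ∀ i, i + 1 < m → src (w (i + 1)) = src (β (w i))
  rank : ∀ i < m, r (w i) = ((Finset.range i).filter (fun j => src (w j) = src (w i))).card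

theorem IsWalk.inj (h : IsWalk src β e₀ r w m) {i j : ℕ} (hi : i < m) (hj : j < m)
    (hij : w i = w j) : i = j := by
  wlog hlt : i < j generalizing i j
  · rcases Nat.lt_or_ge j i with h' | h'
    · exact (this hj hi hij.symm h').symm
    · omega
  exfalso
  have h1 := h.rank i hi
  have h2 := h.rank j hj
  rw [← hij, h1] at h2
  refine h2.not_lt (Finset.card_lt_card ?_)
  rw [Finset.ssubset_iff_of_subset]
  · exact ⟨i, by simp [hlt], by simp⟩
  · intro l hl
    simp only [Finset.mem_filter, Finset.mem_range] at hl ⊢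
    exact ⟨hl.1.trans hlt, hl.2⟩

theorem IsWalk.le_card (h : IsWalk src β e₀ r w m) : m ≤ Fintype.card E := by
  have := Fintype.card_le_of_injective (fun i : Fin m => w i)
    (fun i j hij => Fin.ext (h.inj i.2 j.2 hij))
  simpa using this

/-- Flow balance at `v`: exits plus an ending at `v` equal entries plus a start at `v`. -/
theorem IsWalk.card_src (h : IsWalk src β e₀ r w (m + 1)) (v : V) :
    ((Finset.range (m + 1)).filter (fun j => src (w j) = v)).card
        + (if src (β (w m)) = v then 1 else 0)
      = ((Finset.range (m + 1)).filter (fun j => src (β (w j)) = v)).card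
        + (if src e₀ = v then 1 else 0) := by
  have key : ∀ i ≤ m, ∑ j ∈ Finset.range (i + 1), (if src (w j) = v then 1 else 0)
        + (if src (β (w i)) = v then 1 else 0)
      = ∑ j ∈ Finset.range (i + 1), (if src (β (w j)) = v then 1 else 0)
        + (if src e₀ = v then 1 else 0) := by
    intro i
    induction i with
    | zero => intro _; simp only [zero_add, Finset.sum_range_one, h.zero]; exact add_comm _ _
    | succ i ih =>
      intro hi
      rw [Finset.sum_range_succ _ (i + 1), Finset.sum_range_succ _ (i + 1),
        h.succ i (by omega)]
      have := ih (by omega)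
      omega
  simpa only [Finset.card_filter] using key m le_rfl

theorem IsWalk.card_image (h : IsWalk src β e₀ r w m) (p : E → Prop) [DecidablePred p] :
    ((Finset.range m).filter (fun j => p (w j))).card ≤ (Finset.univ.filter p).card := by
  refine Finset.card_le_card_of_injOn w (fun j hj => ?_) (fun i hi j hj hij => ?_)
  · simpa using (Finset.mem_filter.1 hj).2
  · simp only [Finset.coe_filter, Finset.mem_range, Set.mem_ofPred_eq] at hi hj
    exact h.inj hi.1 hj.1 hij

/-- A walk repeats no edge, so if it uses as many edges satisfying `p` as there are, it uses all of
them. -/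
theorem IsWalk.exists_eq (h : IsWalk src β e₀ r w m) (p : E → Prop) [DecidablePred p]
    (hc : (Finset.univ.filter p).card ≤ ((Finset.range m).filter (fun j => p (w j))).card)
    {e : E} (he : p e) : ∃ i < m, w i = e := by
  classical
  have hsub : ((Finset.range m).filter (fun j => p (w j))).image w ⊆ Finset.univ.filter p := by
    intro f hf
    obtain ⟨j, hj, rfl⟩ := Finset.mem_image.1 hf
    simpa using (Finset.mem_filter.1 hj).2
  have heq := Finset.eq_of_subset_of_card_le hsub (by
    rw [Finset.card_image_of_injOn]
    · exact hc
    · intro i hi j hj hij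
      simp only [Finset.coe_filter, Finset.mem_range, Set.mem_ofPred_eq] at hi hj
      exact h.inj hi.1 hj.1 hij)
  have hmem : e ∈ Finset.univ.filter p := by simpa using he
  rw [← heq, Finset.mem_image] at hmem
  obtain ⟨i, hi, rfl⟩ := hmem
  exact ⟨i, Finset.mem_range.1 (Finset.mem_filter.1 hi).1, rfl⟩

/-- Indegree equals outdegree, because `β` is a bijection. -/
theorem card_filter_comp (src : E → V) (hβ : Function.Bijective β) (v : V) :
    (Finset.univ.filter (fun e => src (β e) = v)).card = outDegree src v := by
  refine Finset.card_bij (fun e _ => β e) (fun e he => by simpa using he)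
    (fun _ _ _ _ h => hβ.1 h) (fun f hf => ?_)
  obtain ⟨e, rfl⟩ := hβ.2 f
  exact ⟨e, by simpa using hf, rfl⟩

theorem IsWalk.extend (h : IsWalk src β e₀ r w (m + 1)) {e : E} (he : src e = src (β (w m)))
    (hr : r e = ((Finset.range (m + 1)).filter (fun j => src (w j) = src e)).card) :
    IsWalk src β e₀ r (fun i => if i = m + 1 then e else w i) (m + 2) := by
  refine ⟨by simpa using h.zero, fun i hi => ?_, fun i hi => ?_⟩
  · rcases Nat.lt_or_ge i m with hlt | hge
    · simpa [show i ≠ m by omega, show i ≠ m + 1 by omega] using h.succ i (by omega)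
    · obtain rfl : i = m := by omega
      simpa using he
  · have hcongr : ∀ v, (Finset.range i).filter
          (fun j => src (if j = m + 1 then e else w j) = v) =
        (Finset.range i).filter (fun j => src (w j) = v) := by
      intro v
      apply Finset.filter_congr
      intro j hj
      rw [Finset.mem_range] at hj
      rw [if_neg (by omega)]
    rw [hcongr]
    by_cases him : i = m + 1
    · subst him
      simpa using hr
    · rw [if_neg him]
      exact h.rank i (by omega)

/-- A maximal walk can stop only at the root vertex, by flow balance. There all edges are used; if
all edges entering a vertex are used, so is the tree edge into it, which is the last exit from its
origin, so all exits of that origin are used as well. Going backwards along the tree reaches every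
vertex. -/
theorem exists_walk (hr : IsExitRank src r) (h0 : r e₀ = 0) (hβ : Function.Bijective β)
    (hreach : ∀ v, Relation.ReflTransGen (StepIn src β (lastExits src (src e₀) r)) v (src e₀)) :
    ∃ w m, IsWalk src β e₀ r w (m + 1) ∧ Fintype.card E = m + 1 ∧ src (β (w m)) = src e₀ := by
  obtain ⟨m, ⟨w, hw⟩, hmax⟩ : ∃ m, (∃ w, IsWalk src β e₀ r w (m + 1)) ∧
      ¬ ∃ w, IsWalk src β e₀ r w (m + 2) := by
    by_contra! hcon
    have hall : ∀ m, ∃ w, IsWalk src β e₀ r w (m + 1) := by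
      intro m
      induction m with
      | zero =>
        refine ⟨fun _ => e₀, rfl, fun i hi => by omega, fun i hi => ?_⟩
        obtain rfl : i = 0 := by omega
        simpa using h0
      | succ m ih => exact hcon m ih
    obtain ⟨w, hw⟩ := hall (Fintype.card E)
    have := hw.le_card
    omega
  -- An unused exit at the final vertex would give an edge whose rank is the number of exits made
  -- there, hence an extension.
  have hclosed : outDegree src (src (β (w m))) ≤
      ((Finset.range (m + 1)).filter (fun j => src (w j) = src (β (w m)))).card := by
    by_contra! hlt
    obtain ⟨e, he, he'⟩ := hr.exists_rank hlt
    exact hmax ⟨_, hw.extend he (by rw [he', he])⟩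
  -- Otherwise the final vertex is entered once more than it is left, although all its exits are
  -- used: more entries than its indegree.
  have hend : src (β (w m)) = src e₀ := by
    by_contra hne
    have h1 := hw.card_src (src (β (w m)))
    rw [if_pos rfl, if_neg (Ne.symm hne)] at h1
    have h2 := hw.card_image (fun e => src (β e) = src (β (w m)))
    rw [card_filter_comp src hβ] at h2
    omega
  have hbal : ∀ v, ((Finset.range (m + 1)).filter (fun j => src (w j) = v)).card =
      ((Finset.range (m + 1)).filter (fun j => src (β (w j)) = v)).card := by
    intro v
    have := hw.card_src v
    rw [hend] at this
    omega
  have hall : ∀ v, outDegree src v ≤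
      ((Finset.range (m + 1)).filter (fun j => src (w j) = v)).card := by
    intro v
    refine (hreach v).head_induction_on (by rw [hend] at hclosed; exact hclosed) ?_
    rintro u x ⟨e, he, rfl, rfl⟩ - ih
    rw [hbal] at ih
    obtain ⟨i, hi, rfl⟩ := hw.exists_eq (fun f => src (β f) = src (β e))
      (by rw [card_filter_comp src hβ]; exact ih) rfl
    -- The edge found is a last exit, so its rank says that all other exits of its origin were made
    -- before it.
    have h1 := hw.rank i hi
    have h2 := he.2
    rw [← h2, h1]
    apply Finset.card_lt_card
    rw [Finset.ssubset_iff_of_subset]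
    · exact ⟨i, by simp; omega, by simp⟩
    · intro l hl
      simp only [Finset.mem_filter, Finset.mem_range] at hl ⊢
      exact ⟨by omega, hl.2⟩
  have hsurj : ∀ e, ∃ i < m + 1, w i = e := fun e =>
    hw.exists_eq (fun f => src f = src e) (hall (src e)) rfl
  refine ⟨w, m, hw, le_antisymm ?_ hw.le_card, hend⟩
  have := Fintype.card_le_of_surjective (fun i : Fin (m + 1) => w i) (fun e => by
    obtain ⟨i, hi, h⟩ := hsurj e
    exact ⟨⟨i, hi⟩, h⟩)
  simpa using this

theorem exists_tour (hr : IsExitRank src r) (h0 : r e₀ = 0) (hβ : Function.Bijective β)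
    (hreach : ∀ v, Relation.ReflTransGen (StepIn src β (lastExits src (src e₀) r)) v (src e₀)) :
    ∃ τ, IsTour src β τ ∧ IsTourRank src e₀ τ r := by
  obtain ⟨w, m, hw, hm, hend⟩ := exists_walk hr h0 hβ hreach
  let W : Fin (m + 1) ≃ E := Equiv.ofBijective (fun i => w i) (by
    rw [Fintype.bijective_iff_injective_and_card]
    exact ⟨fun i j hij => Fin.ext (hw.inj i.2 j.2 hij), by simp [hm]⟩)
  have hW : ∀ i, W i = w i := fun _ => rfl
  let τ : Equiv.Perm E := (W.symm.trans (finRotate (m + 1))).trans W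
  have hτ : ∀ i, τ (W i) = W (i + 1) := by
    intro i
    simp [τ]
  have hsucc : ∀ i < m, τ (w i) = w (i + 1) := by
    intro i hi
    have := hτ ⟨i, by omega⟩
    rw [hW, hW] at this
    rw [this, Fin.val_add_one_of_lt (by simpa [Fin.lt_def] using hi)]
  have hlast : τ (w m) = w 0 := by
    have := hτ (Fin.last m)
    rwa [hW, hW, Fin.last_add_one] at this
  have hpow : ∀ i < m + 1, (τ ^ i) e₀ = w i := by
    intro i
    induction i with
    | zero => intro _; exact hw.zero.symm
    | succ i ih =>
      intro hi
      rw [pow_succ', Equiv.Perm.mul_apply, ih (by omega), hsucc i (by omega)]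
  have hcyc : ∀ e, τ.SameCycle e₀ e := by
    intro e
    obtain ⟨i, rfl⟩ := W.surjective e
    exact ⟨(i : ℕ), by rw [zpow_natCast]; exact hpow i i.2⟩
  refine ⟨τ, ⟨fun e => ?_, fun e f => (hcyc e).symm.trans (hcyc f)⟩, fun i hi => ?_⟩
  · obtain ⟨i, rfl⟩ := W.surjective e
    rw [hW]
    rcases Nat.lt_or_ge i m with hlt | hge
    · rw [hsucc i hlt, hw.succ i (by omega)]
    · rw [show (i : ℕ) = m by omega, hlast, hend, hw.zero]
  · rw [hm] at hi
    rw [hpow i hi, hw.rank i hi]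
    congr 1
    apply Finset.filter_congr
    intro j hj
    rw [hpow j ((Finset.mem_range.1 hj).trans hi)]

end Walk

/-! ### The BEST bijection as a relation -/

section Correspondence

variable {src : E → V} {β : E → E} {e₀ : E} {τ τ' σ σ' : Equiv.Perm E} {A A' : Set E}

theorem exists_rotation_of_tour (hsrc : Function.Surjective src) (hτ : IsTour src β τ) (e₀ : E) :
    ∃ σ A, IsRotation src σ ∧ IsOutTree src β (src e₀) A ∧ BestRel src e₀ τ σ A := by
  obtain ⟨r, hr⟩ := exists_isTourRank hτ e₀
  obtain ⟨σ, hσ, hσr⟩ := exists_rotation (hr.isExitRank hτ) hr.zero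
  exact ⟨σ, _, hσ, isOutTree_lastExits hsrc hτ hr, r, hr, hσr⟩

theorem exists_tour_of_rotation (hβ : Function.Bijective β) (hσ : IsRotation src σ)
    (hA : IsOutTree src β (src e₀) A) : ∃ τ, IsTour src β τ ∧ BestRel src e₀ τ σ A := by
  obtain ⟨r, hr⟩ := exists_isRotRank hσ hA
  obtain ⟨τ, hτ, hτr⟩ := exists_tour (hr.isExitRank hσ hA) hr.zero hβ
    (by rw [← hr.eq_lastExits hσ hA]; exact hA.reach)
  exact ⟨τ, hτ, r, hτr, hr⟩

theorem BestRel.unique_rotation (hτ : IsTour src β τ) (hσ : IsRotation src σ)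
    (hA : IsOutTree src β (src e₀) A) (h : BestRel src e₀ τ σ A) (hσ' : IsRotation src σ')
    (hA' : IsOutTree src β (src e₀) A') (h' : BestRel src e₀ τ σ' A') : σ = σ' ∧ A = A' := by
  obtain ⟨r, h1, h2⟩ := h
  obtain ⟨r', h1', h2'⟩ := h'
  obtain rfl := h1.unique_rank hτ h1'
  exact h2.unique_rotation hσ hA hσ' hA' h2'

theorem BestRel.unique_tour (hτ : IsTour src β τ) (hτ' : IsTour src β τ')
    (h : BestRel src e₀ τ σ A) (h' : BestRel src e₀ τ' σ A) : τ = τ' := by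
  obtain ⟨r, h1, h2⟩ := h
  obtain ⟨r', h1', h2'⟩ := h'
  obtain rfl := h2.unique_rank h2'
  exact h1.unique_tour hτ hτ' h1'

/-- The relation depends only on the structure, not on the names of the edges; this lets it descend
to isomorphism classes. -/
theorem BestRel.map (h : BestRel src e₀ τ σ A) (g : Equiv.Perm E) {src' : E → V}
    (hsrc : ∀ e, src' (g e) = src e) (hτ : ∀ e, τ' (g e) = g (τ e)) (hσ : ∀ e, σ' (g e) = g (σ e))
    (hA : ∀ e, g e ∈ A' ↔ e ∈ A) : BestRel src' (g e₀) τ' σ' A' := by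
  obtain ⟨r, h1, h2⟩ := h
  have hp : ∀ j, (τ' ^ j) (g e₀) = g ((τ ^ j) e₀) := by
    intro j
    induction j with
    | zero => rfl
    | succ j ih => rw [pow_succ', pow_succ', Equiv.Perm.mul_apply, ih, hτ, Equiv.Perm.mul_apply]
  refine ⟨fun e => r (g.symm e), fun i hi => ?_, fun e => ?_⟩
  · simp only [hp, Equiv.symm_apply_apply, hsrc]
    exact h1 i hi
  · obtain ⟨e, rfl⟩ := g.surjective e
    simp only [hσ, hA, Equiv.symm_apply_apply, g.injective.eq_iff]
    exact h2 e

end Correspondence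

end EulerTours

/-! ### Invariants of cycles, cyclic induction, transitivity -/

theorem eq_of_sameCycle {α β : Type*} {f : Equiv.Perm α} {F : α → β} (h : ∀ x, F (f x) = F x)
    {a b : α} (hab : f.SameCycle a b) : F a = F b := by
  obtain ⟨i, rfl⟩ := hab
  induction i with
  | zero => rfl
  | succ i ih => rw [add_comm, zpow_one_add, Equiv.Perm.mul_apply, h, ← ih]
  | pred i ih =>
    rw [ih, ← h ((f ^ (-(i : ℤ) - 1)) a), ← Equiv.Perm.mul_apply, ← zpow_one_add]
    congr 3
    ring

/-- Induction around the cycle of types: climb from `t₀` to the last type, wrap around to `0`, then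
climb to any `t`. -/
theorem fin_forall_of_add_one {k : ℕ} [NeZero k] {P : Fin k → Prop} (h : ∀ t, P t → P (t + 1))
    {t₀ : Fin k} (h₀ : P t₀) (t : Fin k) : P t := by
  obtain ⟨m, rfl⟩ : ∃ m, k = m + 1 := ⟨k - 1, by have := NeZero.pos k; omega⟩
  have hlast : P (Fin.last m) := by
    revert h₀
    refine Fin.reverseInduction (motive := fun t => P t → P (Fin.last m)) id (fun i ih hi => ?_) t₀
    apply ih
    rw [← Fin.coeSucc_eq_succ]
    exact h _ hi
  refine Fin.induction ?_ (fun i hi => ?_) t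
  · rw [← Fin.last_add_one]
    exact h _ hlast
  · rw [← Fin.coeSucc_eq_succ]
    exact h _ hi

theorem fin_forall_of_of_add_one {k : ℕ} [NeZero k] {P : Fin k → Prop} (h : ∀ t, P (t + 1) → P t)
    {t₀ : Fin k} (h₀ : P t₀) (t : Fin k) : P t := by
  by_contra ht
  exact fin_forall_of_add_one (P := fun t => ¬ P t) (fun t => mt (h t)) ht t₀ h₀

/-- Apply the hypothesis to the predicate of lying in the orbit of `x`. -/
theorem isPretransitive_closure {α : Type*} (s : Set (Equiv.Perm α))
    (h : ∀ P : α → Prop, (∀ f ∈ s, ∀ x, P x ↔ P (f x)) → ∀ x y, P x → P y) :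
    MulAction.IsPretransitive (Subgroup.closure s) α := by
  refine ⟨fun x y => ?_⟩
  refine h (fun y => ∃ g : Subgroup.closure s, g • x = y) (fun f hf z => ?_) x y ⟨1, one_smul _ _⟩
  have hf' := Subgroup.subset_closure hf
  constructor
  · rintro ⟨g, rfl⟩
    exact ⟨⟨f, hf'⟩ * g, mul_smul _ _ _⟩
  · rintro ⟨g, hg⟩
    refine ⟨⟨f, hf'⟩⁻¹ * g, ?_⟩
    rw [mul_smul, hg]
    exact inv_smul_smul (⟨f, hf'⟩ : Subgroup.closure s) z

/-! ### Maps in coordinates -/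

namespace CMap

variable {M : CMap}

theorem vertex_eq_iff {d d' : M.Dart} : vertex d = vertex d' ↔ M.rot.SameCycle d d' :=
  Quotient.eq (r := Equiv.Perm.SameCycle.setoid M.rot)

theorem edge_eq_iff {d d' : M.Dart} : edge d = edge d' ↔ M.opp.SameCycle d d' :=
  Quotient.eq (r := Equiv.Perm.SameCycle.setoid M.opp)

theorem face_eq_iff {d d' : M.Dart} : face d = face d' ↔ M.facePerm.SameCycle d d' :=
  Quotient.eq (r := Equiv.Perm.SameCycle.setoid M.facePerm)

theorem exists_vertex_eq (v : M.Vertex) : ∃ d, vertex d = v := Quotient.exists_rep v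

theorem exists_edge_eq (e : M.Edge) : ∃ d, edge d = e := Quotient.exists_rep e

theorem exists_face_eq (f : M.Face) : ∃ d, face d = f := Quotient.exists_rep f

theorem vertex_rot (d : M.Dart) : vertex (M.rot d) = vertex d :=
  vertex_eq_iff.2 (Equiv.Perm.sameCycle_apply_left.2 (Equiv.Perm.SameCycle.refl _ _))

theorem vertex_rot_inv (d : M.Dart) : vertex (M.rot⁻¹ d) = vertex d := by
  rw [← vertex_rot, apply_inv_apply]

theorem edge_opp (d : M.Dart) : edge (M.opp d) = edge d :=
  edge_eq_iff.2 (Equiv.Perm.sameCycle_apply_left.2 (Equiv.Perm.SameCycle.refl _ _))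

theorem face_facePerm (d : M.Dart) : face (M.facePerm d) = face d :=
  face_eq_iff.2 (Equiv.Perm.sameCycle_apply_left.2 (Equiv.Perm.SameCycle.refl _ _))

/-- Powers of the involution `opp` are `1` or `opp`, according to parity. -/
theorem edge_eq_edge {d d' : M.Dart} (h : edge d = edge d') : d' = d ∨ d' = M.opp d := by
  obtain ⟨i, rfl⟩ := edge_eq_iff.1 h
  have hsq : M.opp ^ (2 : ℤ) = 1 := by
    ext x
    rw [zpow_two]
    exact M.opp_opp x
  obtain ⟨j, rfl | rfl⟩ := Int.even_or_odd' i
  · left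
    rw [zpow_mul, hsq, one_zpow]
    rfl
  · right
    rw [zpow_add, zpow_mul, hsq, one_zpow, one_mul, zpow_one]

/-- The half-edges of `M` are parametrized by triples: the half-edge `(a, t, true)` has the
hyperedge `a` on its left and starts at a vertex of type `t`, and it is preceded by `(a, t, false)`
in clockwise order. The permutation `π t` gives the counterclockwise order of the hyperedges around
the vertices of type `t`. -/
structure Chart (M : CMap) {n k : ℕ} [NeZero k] (π : Fin k → Equiv.Perm (Fin n)) where
  toEquiv : Fin n × Fin k × Bool ≃ M.Dart
  rot_true : ∀ a t, M.rot (toEquiv (a, t, true)) = toEquiv ((π t)⁻¹ a, t, false)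
  rot_false : ∀ a t, M.rot (toEquiv (a, t, false)) = toEquiv (a, t, true)
  opp_false : ∀ a t, M.opp (toEquiv (a, t, false)) = toEquiv (a, t + 1, true)

namespace Chart

variable {n k : ℕ} [NeZero k] {π : Fin k → Equiv.Perm (Fin n)} (g : M.Chart π)

theorem opp_true (a : Fin n) (t : Fin k) :
    M.opp (g.toEquiv (a, t + 1, true)) = g.toEquiv (a, t, false) := by
  rw [← g.opp_false, M.opp_opp]

theorem facePerm_true (a : Fin n) (t : Fin k) :
    M.facePerm (g.toEquiv (a, t + 1, true)) = g.toEquiv (a, t, true) := by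
  rw [facePerm, Equiv.Perm.mul_apply, g.opp_true, g.rot_false]

theorem facePerm_false (a : Fin n) (t : Fin k) :
    M.facePerm (g.toEquiv (a, t, false)) = g.toEquiv ((π (t + 1))⁻¹ a, t + 1, false) := by
  rw [facePerm, Equiv.Perm.mul_apply, g.opp_false, g.rot_true]

theorem vertex_false (a : Fin n) (t : Fin k) :
    vertex (g.toEquiv (a, t, false)) = vertex (g.toEquiv (a, t, true)) := by
  rw [← g.rot_false, vertex_rot]

theorem vertex_eq_true (a : Fin n) (t : Fin k) (b : Bool) :
    vertex (g.toEquiv (a, t, b)) = vertex (g.toEquiv (a, t, true)) := by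
  cases b
  · exact g.vertex_false a t
  · rfl

theorem vertex_perm (a : Fin n) (t : Fin k) :
    vertex (g.toEquiv (π t a, t, true)) = vertex (g.toEquiv (a, t, true)) := by
  rw [← vertex_rot, g.rot_true, inv_apply_apply, g.vertex_false]

theorem exists_vertex (v : M.Vertex) : ∃ a t, vertex (g.toEquiv (a, t, true)) = v := by
  obtain ⟨d, rfl⟩ := exists_vertex_eq v
  obtain ⟨⟨a, t, b⟩, rfl⟩ := g.toEquiv.surjective d
  exact ⟨a, t, (g.vertex_eq_true a t b).symm⟩

theorem exists_edge (e : M.Edge) : ∃ a t, edge (g.toEquiv (a, t, false)) = e := by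
  obtain ⟨d, rfl⟩ := exists_edge_eq e
  obtain ⟨⟨a, t, b⟩, rfl⟩ := g.toEquiv.surjective d
  cases b
  · exact ⟨a, t, rfl⟩
  · refine ⟨a, t - 1, ?_⟩
    rw [← g.opp_true, edge_opp, sub_add_cancel]

theorem vertex_sameCycle {a b : Fin n} {t : Fin k}
    (h : vertex (g.toEquiv (a, t, true)) = vertex (g.toEquiv (b, t, true))) :
    (π t).SameCycle a b := by
  -- The pair of the type and the cycle of `π t` is unchanged by `rot`, so it separates vertices.
  let F : M.Dart → (s : Fin k) × Quotient (Equiv.Perm.SameCycle.setoid (π s)) :=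
    fun d => ⟨(g.toEquiv.symm d).2.1, Quotient.mk _ (g.toEquiv.symm d).1⟩
  have hF : ∀ d, F (M.rot d) = F d := by
    intro d
    obtain ⟨⟨a, t, b⟩, rfl⟩ := g.toEquiv.surjective d
    cases b
    · rw [g.rot_false]
      simp only [F]
      rw [Equiv.symm_apply_apply, Equiv.symm_apply_apply]
    · rw [g.rot_true]
      simp only [F]
      rw [Equiv.symm_apply_apply, Equiv.symm_apply_apply]
      congr 1
      refine Quotient.sound (s := Equiv.Perm.SameCycle.setoid (π t)) ⟨1, ?_⟩
      rw [zpow_one, apply_inv_apply]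
  have h1 := eq_of_sameCycle hF (vertex_eq_iff.1 h)
  simp only [F] at h1
  rw [Equiv.symm_apply_apply, Equiv.symm_apply_apply] at h1
  exact Quotient.exact (s := Equiv.Perm.SameCycle.setoid (π t)) (eq_of_heq (Sigma.mk.inj h1).2)

theorem vertex_eq_of_sameCycle {a b : Fin n} {t : Fin k} (h : (π t).SameCycle a b) :
    vertex (g.toEquiv (a, t, true)) = vertex (g.toEquiv (b, t, true)) :=
  eq_of_sameCycle (F := fun a => vertex (g.toEquiv (a, t, true))) (fun a => g.vertex_perm a t) h

theorem edge_inj {a b : Fin n} {s t : Fin k}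
    (h : edge (g.toEquiv (a, s, false)) = edge (g.toEquiv (b, t, false))) : a = b ∧ s = t := by
  rcases edge_eq_edge h with h | h
  · simpa [eq_comm] using h
  · rw [g.opp_false] at h
    simp at h

theorem face_true (a : Fin n) (s t : Fin k) :
    face (g.toEquiv (a, s, true)) = face (g.toEquiv (a, t, true)) := by
  refine fin_forall_of_of_add_one (P := fun s => face (g.toEquiv (a, s, true)) = _)
    (fun s hs => ?_) rfl s
  rw [← hs, ← g.facePerm_true, face_facePerm]

theorem face_invariant (a b : Fin n) (s t : Fin k) (c c' : Bool)
    (h : face (g.toEquiv (a, s, c)) = face (g.toEquiv (b, t, c'))) :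
    c = c' ∧ (c = true → a = b) := by
  -- This face invariant is the hyperedge on the left of a half-edge, or `none` when that face is
  -- white.
  let F : M.Dart → Option (Fin n) :=
    fun d => if (g.toEquiv.symm d).2.2 then some (g.toEquiv.symm d).1 else none
  have hF : ∀ d, F (M.facePerm d) = F d := by
    intro d
    obtain ⟨⟨a, t, b⟩, rfl⟩ := g.toEquiv.surjective d
    cases b
    · simp [F, g.facePerm_false]
    · obtain ⟨t, rfl⟩ : ∃ t', t = t' + 1 := ⟨t - 1, by simp⟩
      simp [F, g.facePerm_true]
  have h1 := eq_of_sameCycle hF (face_eq_iff.1 h)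
  cases c <;> cases c' <;> simp_all [F]

end Chart

end CMap

/-! ### The constellation built from a tuple of permutations -/

section Model

variable {n k : ℕ} [NeZero k] (π : Fin k → Equiv.Perm (Fin n))

/-- The rotation system of the constellation given by the permutations `π`. -/
def modelRot : Equiv.Perm (Fin n × Fin k × Bool) where
  toFun d := match d with
    | (a, t, true) => ((π t)⁻¹ a, t, false)
    | (a, t, false) => (a, t, true)
  invFun d := match d with
    | (a, t, true) => (a, t, false)
    | (a, t, false) => (π t a, t, true)
  left_inv := by rintro ⟨a, t, _ | _⟩ <;> simp
  right_inv := by rintro ⟨a, t, _ | _⟩ <;> simp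

/-- The involution exchanging the halves of the edges of a constellation. -/
def modelOpp (n k : ℕ) [NeZero k] : Equiv.Perm (Fin n × Fin k × Bool) where
  toFun d := match d with
    | (a, t, true) => (a, t - 1, false)
    | (a, t, false) => (a, t + 1, true)
  invFun d := match d with
    | (a, t, true) => (a, t - 1, false)
    | (a, t, false) => (a, t + 1, true)
  left_inv := by rintro ⟨a, t, _ | _⟩ <;> simp
  right_inv := by rintro ⟨a, t, _ | _⟩ <;> simp

/-- The edges `(a, t)` can be connected to each other around hyperedges and vertices. -/
def IsConnectedTuple : Prop :=
  ∀ P : Fin n × Fin k → Prop, (∀ a t, P (a, t) ↔ P (a, t + 1)) → (∀ a t, P (π t a, t) ↔ P (a, t)) →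
    ∀ x y, P x → P y

variable {π}

/-- The map given by the permutations `π`. -/
def modelMap (r : Fin n) (h : IsConnectedTuple π) : CMap where
  Dart := Fin n × Fin k × Bool
  finite_dart := inferInstance
  nonempty_dart := ⟨(r, 0, true)⟩
  rot := modelRot π
  opp := modelOpp n k
  opp_opp := by rintro ⟨a, t, _ | _⟩ <;> simp [modelOpp]
  opp_ne := by rintro ⟨a, t, _ | _⟩ <;> simp [modelOpp]
  connected := by
    refine isPretransitive_closure _ fun P hP => ?_
    have hrot := hP _ (Or.inl rfl)
    have hopp := hP _ (Or.inr rfl)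
    have h1 : ∀ a t, P (a, t, false) ↔ P (a, t, true) := fun a t => hrot (a, t, false)
    have h2 : ∀ a t, P (a, t, false) ↔ P (a, t + 1, true) := fun a t => hopp (a, t, false)
    have h3 : ∀ a t, P (π t a, t, true) ↔ P (a, t, false) := fun a t => by
      rw [hrot]
      simp [modelRot]
    have h4 := h (fun x => P (x.1, x.2, true)) (fun a t => by rw [← h1, h2])
      (fun a t => by rw [h3, h1])
    have h5 : ∀ a t b, P (a, t, b) ↔ P (a, t, true) := by
      rintro a t (_ | _)
      · exact h1 a t
      · rfl
    rintro ⟨a, t, b⟩ ⟨a', t', b'⟩ hx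
    rw [h5] at hx ⊢
    exact h4 (a, t) (a', t') hx

/-- The identity chart of `modelMap`. -/
def modelMapChart (r : Fin n) (h : IsConnectedTuple π) : (modelMap r h).Chart π where
  toEquiv := Equiv.refl _
  rot_true _ _ := rfl
  rot_false _ _ := rfl
  opp_false _ _ := rfl

/-- The constellation given by the permutations `π`. -/
def model (r : Fin n) (h : IsConnectedTuple π) : Constellation k where
  toCMap := modelMap r h
  black := Quotient.lift (fun d : Fin n × Fin k × Bool => d.2.2) (by
    intro d d' hd
    exact ((modelMapChart r h).face_invariant d.1 d'.1 d.2.1 d'.2.1 _ _ (face_eq_iff.2 hd)).1)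
  typ := Quotient.lift (fun d : Fin n × Fin k × Bool => d.2.1) (by
    intro d d' hd
    refine eq_of_sameCycle (f := modelRot π) (F := fun d : Fin n × Fin k × Bool => d.2.1) ?_ hd
    rintro ⟨a, t, _ | _⟩ <;> rfl)
  separates := by rintro ⟨a, t, _ | _⟩ <;> rfl
  degree_black := by
    intro f hf
    obtain ⟨⟨a, t, b⟩, rfl⟩ := exists_face_eq f
    obtain rfl : b = true := hf
    -- The half-edges with the hyperedge `a` on their left are indexed by their types, whence degree
    -- `k`.
    have hbij : Function.Bijective (fun s : Fin k =>
        (⟨(a, s, true), (modelMapChart r h).face_true a s t⟩ :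
          {d : (modelMap r h).Dart // face d = face (M := modelMap r h) (a, t, true)})) := by
      refine ⟨fun s s' hs => ?_, ?_⟩
      · have := congrArg (fun x => x.1.2.1) hs
        exact this
      · rintro ⟨⟨a', s, b⟩, hb⟩
        obtain ⟨rfl, h2⟩ := (modelMapChart r h).face_invariant a a' t s true b hb.symm
        obtain rfl := h2 rfl
        exact ⟨s, rfl⟩
    rw [faceDegree, ← Nat.card_eq_of_bijective _ hbij, Nat.card_fin]
  typ_black := by
    rintro ⟨a, t, b⟩ hb
    obtain rfl : b = true := hb
    have := (modelMapChart r h).facePerm_true a (t - 1)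
    rw [sub_add_cancel] at this
    have h2 : (modelMap r h).facePerm (a, t, true) = (a, t - 1, true) := this
    rw [h2]
    exact (sub_add_cancel t 1).symm

end Model

/-! ### Every constellation has coordinates -/

namespace Constellation

variable {k : ℕ} [NeZero k]

/-- A chart of the underlying map which is compatible with the colours of the faces and the types of
the vertices. -/
structure Chart (C : Constellation k) {n : ℕ} (π : Fin k → Equiv.Perm (Fin n)) extends
    CMap.Chart C.toCMap π where
  black : ∀ a t b, C.black (face (toEquiv (a, t, b))) = b
  typ : ∀ a t b, C.typ (vertex (toEquiv (a, t, b))) = t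

/-- The identity chart of `model`. -/
def modelChart {n : ℕ} {π : Fin k → Equiv.Perm (Fin n)} (r : Fin n) (h : IsConnectedTuple π) :
    (model r h).Chart π where
  toChart := modelMapChart r h
  black _ _ _ := rfl
  typ _ _ _ := rfl

section ExistsChart

variable {C : Constellation k}

theorem black_rot (d : C.Dart) : C.black (face (C.rot d)) = !C.black (face d) := by
  rw [← C.separates d]
  congr 1
  exact (face_eq_of_facePerm (by rw [facePerm, Equiv.Perm.mul_apply, C.opp_opp])).symm

theorem black_rot_inv (d : C.Dart) : C.black (face (C.rot⁻¹ d)) = !C.black (face d) := by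
  have := black_rot (C.rot⁻¹ d)
  rw [apply_inv_apply] at this
  simp [this]

/-- Types change by one at each step around a black face, so all `k` types occur; the degree being
`k`, each occurs once. -/
theorem typ_bijective (h : C.Hyperedge) :
    Function.Bijective (fun d : {d : C.Dart // face d = h.1} => C.typ (vertex d.1)) := by
  have := C.finite_dart
  refine Function.Surjective.bijective_of_nat_card_le (fun t => ?_) ?_
  · obtain ⟨d₀, hd₀⟩ := exists_face_eq h.1
    obtain ⟨d, hd, ht⟩ := fin_forall_of_of_add_one
      (P := fun t => ∃ d : C.Dart, face d = h.1 ∧ C.typ (vertex d) = t)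
      (fun t ⟨d, hd, ht⟩ => ⟨C.facePerm d, by rw [face_facePerm, hd], by
        rw [C.typ_black d (by rw [hd, h.2])] at ht
        exact add_right_cancel ht⟩)
      (⟨d₀, hd₀, rfl⟩ : ∃ d : C.Dart, face d = h.1 ∧ C.typ (vertex d) = C.typ (vertex d₀)) t
    exact ⟨⟨d, hd⟩, ht⟩
  · have := C.degree_black h.1 h.2
    rw [faceDegree] at this
    rw [this, Nat.card_fin]

theorem dart_ext {d d' : C.Dart} (h : C.black (face d) = true) (hf : face d = face d')
    (ht : C.typ (vertex d) = C.typ (vertex d')) : d = d' := by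
  have := (typ_bijective (⟨face d, h⟩ : C.Hyperedge)).1 (a₁ := ⟨d, rfl⟩) (a₂ := ⟨d', hf.symm⟩) ht
  exact congrArg Subtype.val this

theorem exists_dart (h : C.Hyperedge) (t : Fin k) :
    ∃ d : C.Dart, face d = h.1 ∧ C.typ (vertex d) = t := by
  obtain ⟨⟨d, hd⟩, ht⟩ := (typ_bijective h).2 t
  exact ⟨d, hd, ht⟩

/-- A half-edge with a black face on its left is determined by that face and its type. This gives
the half-edges `(a, t, true)`; their clockwise predecessors have a white face on the left and
account for all the others. -/
theorem exists_chart {n : ℕ} (l : C.Hyperedge ≃ Fin n) :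
    ∃ π : Fin k → Equiv.Perm (Fin n), ∃ g : C.Chart π,
      ∀ a t h, l (hyperedge (g.toEquiv (a, t, true)) h) = a := by
  choose dt hface htyp using fun (a : Fin n) (t : Fin k) => exists_dart (l.symm a) t
  have hblack : ∀ a t, C.black (face (dt a t)) = true := fun a t => by
    rw [hface]; exact (l.symm a).2
  have hl : ∀ a t h, l (hyperedge (dt a t) h) = a := by
    intro a t h
    rw [← Equiv.eq_symm_apply]
    exact Subtype.ext (hface a t)
  have hdt : ∀ (d : C.Dart) (h : C.black (face d) = true),
      dt (l (hyperedge d h)) (C.typ (vertex d)) = d := by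
    intro d h
    apply dart_ext (hblack _ _) _ (htyp _ _)
    rw [hface, Equiv.symm_apply_apply]
    rfl
  have hnext : ∀ a t, C.black (face (C.rot⁻¹ (C.rot⁻¹ (dt a t)))) = true := fun a t =>
    black_next (hblack a t)
  -- Two half-edges counterclockwise lies the next hyperedge around the same vertex.
  let p : Fin k → Fin n → Fin n := fun t a => l (hyperedge _ (hnext a t))
  have hp : ∀ t a, dt (p t a) t = C.rot⁻¹ (C.rot⁻¹ (dt a t)) := by
    intro t a
    have := hdt _ (hnext a t)
    rwa [vertex_rot_inv, vertex_rot_inv, htyp] at this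
  have hpinj : ∀ t, Function.Injective (p t) := by
    intro t a b hab
    have h1 : dt a t = dt b t := by
      apply (C.rot⁻¹).injective
      apply (C.rot⁻¹).injective
      rw [← hp, ← hp, hab]
    rw [← hl a t (hblack a t), ← hl b t (hblack b t)]
    simp only [h1]
  let π : Fin k → Equiv.Perm (Fin n) := fun t =>
    Equiv.ofBijective (p t) (Finite.injective_iff_bijective.1 (hpinj t))
  have hπ : ∀ t a, π t a = p t a := fun _ _ => rfl
  let G : Fin n × Fin k × Bool → C.Dart := fun x =>
    match x with
    | (a, t, true) => dt a t
    | (a, t, false) => C.rot⁻¹ (dt a t)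
  have hGb : ∀ a t b, C.black (face (G (a, t, b))) = b := by
    rintro a t (_ | _)
    · simp only [G, black_rot_inv, hblack, Bool.not_true]
    · exact hblack a t
  have hGt : ∀ a t b, C.typ (vertex (G (a, t, b))) = t := by
    rintro a t (_ | _)
    · simp only [G, vertex_rot_inv, htyp]
    · exact htyp a t
  have hG : Function.Bijective G := by
    constructor
    · rintro ⟨a, t, b⟩ ⟨a', t', b'⟩ h
      obtain rfl : b = b' := by rw [← hGb a t b, h, hGb]
      obtain rfl : t = t' := by rw [← hGt a t b, h, hGt]
      have h1 : dt a t = dt a' t := by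
        cases b
        · exact (C.rot⁻¹).injective h
        · exact h
      rw [← hl a t (hblack a t), ← hl a' t (hblack a' t)]
      simp only [h1]
    · intro d
      cases hd : C.black (face d)
      · have h1 : C.black (face (C.rot d)) = true := by rw [black_rot, hd]; rfl
        refine ⟨(l (hyperedge (C.rot d) h1), C.typ (vertex (C.rot d)), false), ?_⟩
        simp only [G, hdt, inv_apply_apply]
      · exact ⟨(l (hyperedge d hd), C.typ (vertex d), true), hdt d hd⟩
  refine ⟨π, ⟨⟨Equiv.ofBijective G hG, fun a t => ?_, fun a t => ?_, fun a t => ?_⟩, hGb, hGt⟩,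
    fun a t h => hl a t h⟩
  · obtain ⟨a, rfl⟩ := (π t).surjective a
    rw [inv_apply_apply, hπ]
    simp only [Equiv.ofBijective_apply, G, hp, apply_inv_apply]
  · simp only [Equiv.ofBijective_apply, G, apply_inv_apply]
  · simp only [Equiv.ofBijective_apply, G]
    have h1 : C.facePerm (C.opp (C.rot⁻¹ (dt a t))) = dt a t := by
      rw [facePerm, Equiv.Perm.mul_apply, C.opp_opp, apply_inv_apply]
    have h2 : face (C.opp (C.rot⁻¹ (dt a t))) = face (dt a t) := face_eq_of_facePerm h1
    have h3 : C.black (face (C.opp (C.rot⁻¹ (dt a t)))) = true := by rw [h2, hblack]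
    apply dart_ext h3
    · rw [h2, hface, hface]
    · rw [C.typ_black _ h3, h1, htyp, htyp]

end ExistsChart

end Constellation

/-! ### Undirected spanning trees and trees directed to a root -/

section SpanningTrees

variable {E V : Type*}

/-- The vertices `u` and `v` are the ends of an edge of `A`, where the edge `e` goes from `src e` to
`src (β e)`. -/
def Joined (src : E → V) (β : E → E) (A : Set E) (u v : V) : Prop :=
  ∃ e ∈ A, (src e = u ∧ src (β e) = v) ∨ (src (β e) = u ∧ src e = v)

variable {src : E → V} {β : E → E} {A : Set E} {v₀ : V}

theorem Joined.symm {u v : V} (h : Joined src β A u v) : Joined src β A v u := by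
  obtain ⟨e, he, h⟩ := h
  exact ⟨e, he, h.symm.imp And.symm And.symm⟩

theorem reflTransGen_joined_symm {u v : V} (h : Relation.ReflTransGen (Joined src β A) u v) :
    Relation.ReflTransGen (Joined src β A) v u := by
  induction h with
  | refl => rfl
  | tail _ h ih => exact ih.head h.symm

theorem exists_iterate_periodic [Finite V] (f : V → V) (u : V) :
    ∃ i, f^[i] u ∈ Function.periodicPts f := by
  obtain ⟨i, j, hne, hij⟩ := Finite.exists_ne_map_eq_of_infinite (fun i : ℕ => f^[i] u)
  wlog hlt : i < j generalizing i j
  · exact this j i hne.symm hij.symm (by omega)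
  refine ⟨i, j - i, by omega, ?_⟩
  rw [Function.IsPeriodicPt, Function.IsFixedPt, ← Function.iterate_add_apply,
    Nat.sub_add_cancel hlt.le]
  exact hij.symm

/-- A periodic orbit of the map following chosen tree edges is a directed cycle; the rest of the
cycle joins the ends of its first edge without using that edge. -/
theorem not_periodic_of_acyclic
    (hacyc : ∀ e ∈ A, ¬ Relation.ReflTransGen (Joined src β (A \ {e})) (src e) (src (β e)))
    (o : V → E) {u : V} (hu : u ∈ Function.periodicPts (fun v => src (β (o v))))
    (h : ∀ i, o ((fun v => src (β (o v)))^[i] u) ∈ A ∧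
      src (o ((fun v => src (β (o v)))^[i] u)) = (fun v => src (β (o v)))^[i] u) : False := by
  set nx : V → V := fun v => src (β (o v)) with hnx
  have hpos := Function.minimalPeriod_pos_of_mem_periodicPts hu
  have hpath : ∀ i, i + 1 ≤ Function.minimalPeriod nx u →
      Relation.ReflTransGen (Joined src β (A \ {o u})) (nx u) (nx^[i + 1] u) := by
    intro i
    induction i with
    | zero => intro _; rfl
    | succ i ih =>
      intro hi
      refine (ih (by omega)).tail ⟨o (nx^[i + 1] u), ⟨(h _).1, fun heq => ?_⟩, Or.inl ⟨(h _).2, ?_⟩⟩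
      · have h1 := (h (i + 1)).2
        rw [Set.mem_singleton_iff] at heq
        rw [heq] at h1
        have h2 := (h 0).2
        rw [Function.iterate_zero, id] at h2
        rw [h2] at h1
        exact Function.not_isPeriodicPt_of_pos_of_lt_minimalPeriod (Nat.succ_ne_zero i)
          (by omega) h1.symm
      · rw [Function.iterate_succ_apply' nx (i + 1)]
  have h1 := hpath (Function.minimalPeriod nx u - 1) (by omega)
  rw [Nat.sub_add_cancel hpos, Function.iterate_minimalPeriod] at h1
  have h0 := h 0
  rw [Function.iterate_zero, id] at h0
  refine hacyc _ h0.1 ?_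
  rw [h0.2]
  exact reflTransGen_joined_symm h1

/-- If a tree edge left `v₀`, every vertex would have an outgoing tree edge; if some vertex did not
reach `v₀`, all vertices met from it would have one and would not reach `v₀` either. By finiteness
either case yields a directed cycle in the tree. -/
theorem isOutTree_of_spanningTree [Finite V] {e₀ : E} (he₀ : src e₀ = v₀)
    (hacyc : ∀ e ∈ A, ¬ Relation.ReflTransGen (Joined src β (A \ {e})) (src e) (src (β e)))
    (hout : ∀ v, v ≠ v₀ → ∃! e, e ∈ A ∧ src e = v) : IsOutTree src β v₀ A := by
  classical
  have hex : ∀ v, ∃ e, v ≠ v₀ → e ∈ A ∧ src e = v := by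
    intro v
    by_cases hv : v = v₀
    -- A default value: nothing is required of the choice at `v₀`.
    · exact ⟨e₀, fun h => absurd hv h⟩
    · obtain ⟨e, he, -⟩ := hout v hv
      exact ⟨e, fun _ => he⟩
  choose o ho using hex
  have hroot : ∀ e ∈ A, src e ≠ v₀ := by
    intro e he hev
    let o' : V → E := fun v => if v = v₀ then e else o v
    have ho' : ∀ v, o' v ∈ A ∧ src (o' v) = v := by
      intro v
      by_cases hv : v = v₀
      · simp only [o', if_pos hv]
        exact ⟨he, hev.trans hv.symm⟩
      · simp only [o', if_neg hv]
        exact ho v hv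
    obtain ⟨i, hi⟩ := exists_iterate_periodic (fun v => src (β (o' v))) v₀
    exact not_periodic_of_acyclic hacyc o' hi fun j => ho' _
  refine ⟨fun v hv => ⟨o v, ho v hv⟩, fun e he f hf hef => ?_, hroot, fun v => ?_⟩
  · exact (hout _ (hroot e he)).unique ⟨he, rfl⟩ ⟨hf, hef.symm⟩
  · by_contra hv
    set nx : V → V := fun v => src (β (o v)) with hnx
    have hne : ∀ u, ¬ Relation.ReflTransGen (StepIn src β A) u v₀ → u ≠ v₀ := by
      rintro u hu rfl
      exact hu .refl
    have hiter : ∀ i, ¬ Relation.ReflTransGen (StepIn src β A) (nx^[i] v) v₀ := by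
      intro i
      induction i with
      | zero => exact hv
      | succ i ih =>
        rw [Function.iterate_succ_apply']
        intro hr
        have := ho _ (hne _ ih)
        exact ih (hr.head ⟨_, this.1, this.2, rfl⟩)
    obtain ⟨i, hi⟩ := exists_iterate_periodic nx v
    refine not_periodic_of_acyclic hacyc o hi fun j => ?_
    rw [← hnx, ← Function.iterate_add_apply]
    exact ho _ (hne _ (hiter _))

theorem IsOutTree.reach_of_ne (hA : IsOutTree src β v₀ A) {e : E} (he : e ∈ A) {x : V}
    (h : Relation.ReflTransGen (StepIn src β A) (src e) x) (hx : src e ≠ x) :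
    Relation.ReflTransGen (StepIn src β A) (src (β e)) x := by
  rcases h.cases_head with h | ⟨z, ⟨f, hf, hfe, rfl⟩, h⟩
  · exact absurd h hx
  · rwa [← hA.unique f hf e he hfe]

theorem IsOutTree.reflTransGen_joined (hA : IsOutTree src β v₀ A) (u v : V) :
    Relation.ReflTransGen (Joined src β A) u v := by
  have key : ∀ w, Relation.ReflTransGen (Joined src β A) w v₀ := fun w =>
    Relation.ReflTransGen.mono (fun _ _ ⟨e, he, h⟩ => ⟨e, he, Or.inl h⟩) _ _ (hA.reach w)
  exact (key u).trans (reflTransGen_joined_symm (key v))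

/-- Whether a vertex reaches `src e` along directed edges does not change across a tree edge other
than `e`, since out-edges are unique. So if the ends of `e` were joined by the other edges, the head
of `e` would reach its tail. Then everything reachable from `src e`, in particular `v₀`, could
return to it, but no tree edge leaves `v₀`. -/
theorem IsOutTree.acyclic (hA : IsOutTree src β v₀ A) {e : E} (he : e ∈ A) :
    ¬ Relation.ReflTransGen (Joined src β (A \ {e})) (src e) (src (β e)) := by
  intro hcon
  have hstep : ∀ f ∈ A, f ≠ e → (Relation.ReflTransGen (StepIn src β A) (src f) (src e) ↔
      Relation.ReflTransGen (StepIn src β A) (src (β f)) (src e)) := by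
    intro f hf hfe
    exact ⟨fun h => hA.reach_of_ne hf h fun hs => hfe (hA.unique f hf e he hs),
      fun h => h.head ⟨f, hf, rfl, rfl⟩⟩
  have hcycle : Relation.ReflTransGen (StepIn src β A) (src (β e)) (src e) := by
    generalize src (β e) = y at hcon
    induction hcon with
    | refl => rfl
    | tail _ h ih =>
      obtain ⟨f, hf, ⟨rfl, rfl⟩ | ⟨rfl, rfl⟩⟩ := h
      · exact (hstep f hf.1 hf.2).1 ih
      · exact (hstep f hf.1 hf.2).2 ih
  have hclosed : ∀ x, Relation.ReflTransGen (StepIn src β A) (src e) x →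
      Relation.ReflTransGen (StepIn src β A) x (src e) := by
    intro x hx
    induction hx with
    | refl => rfl
    | tail _ h ih =>
      obtain ⟨f, hf, rfl, rfl⟩ := h
      by_cases hfe : f = e
      · rw [hfe]
        exact hcycle
      · exact (hstep f hf hfe).1 ih
  rcases (hclosed v₀ (hA.reach _)).cases_head with h | ⟨z, ⟨f, hf, hfe, -⟩, -⟩
  · exact hA.ne_root e he h.symm
  · exact hA.ne_root f hf hfe

end SpanningTrees

/-! ### Tuples of permutations as permutations of the edges -/

section EdgePermutations

set_option linter.unusedSectionVars false

variable {n k : ℕ} [NeZero k] {p : Fin k → ℕ}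

/-- The origin of the edge of type `x.2` of the hyperedge `x.1`. -/
def edgeSrc (φ : (t : Fin k) → Fin n → Fin (p t)) (x : Fin n × Fin k) : (t : Fin k) × Fin (p t) :=
  ⟨x.2, φ x.2 x.1⟩

/-- The next edge around the hyperedge. -/
def shiftPerm (n k : ℕ) [NeZero k] : Equiv.Perm (Fin n × Fin k) :=
  Equiv.prodCongr (Equiv.refl _) (Equiv.addRight 1)

/-- The permutations `π t`, acting on the edges of type `t`. -/
def rotPerm (π : Fin k → Equiv.Perm (Fin n)) : Equiv.Perm (Fin n × Fin k) where
  toFun x := (π x.2 x.1, x.2)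
  invFun x := ((π x.2)⁻¹ x.1, x.2)
  left_inv x := by simp
  right_inv x := by simp

/-- The next edge around the white face. -/
def tourPerm (π : Fin k → Equiv.Perm (Fin n)) : Equiv.Perm (Fin n × Fin k) :=
  (rotPerm π)⁻¹ * shiftPerm n k

theorem shiftPerm_apply (a : Fin n) (t : Fin k) : shiftPerm n k (a, t) = (a, t + 1) := rfl

theorem rotPerm_apply (π : Fin k → Equiv.Perm (Fin n)) (a : Fin n) (t : Fin k) :
    rotPerm π (a, t) = (π t a, t) := rfl

theorem tourPerm_apply (π : Fin k → Equiv.Perm (Fin n)) (a : Fin n) (t : Fin k) :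
    tourPerm π (a, t) = ((π (t + 1))⁻¹ a, t + 1) := rfl

theorem rotPerm_zpow (π : Fin k → Equiv.Perm (Fin n)) (a : Fin n) (t : Fin k) (i : ℤ) :
    (rotPerm π ^ i) (a, t) = ((π t ^ i) a, t) := by
  induction i with
  | zero => rfl
  | succ i ih =>
    rw [add_comm, zpow_one_add, zpow_one_add, Equiv.Perm.mul_apply, ih]
    rfl
  | pred i ih =>
    rw [sub_eq_neg_add, zpow_add, zpow_add, Equiv.Perm.mul_apply, ih, zpow_neg_one, zpow_neg_one]
    rfl

theorem sameCycle_rotPerm {π : Fin k → Equiv.Perm (Fin n)} {a b : Fin n} {t : Fin k} :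
    (rotPerm π).SameCycle (a, t) (b, t) ↔ (π t).SameCycle a b := by
  simp only [Equiv.Perm.SameCycle, rotPerm_zpow, Prod.mk.injEq, and_true]

/-- A permutation preserving types splits into one permutation of `Fin n` for each type. -/
theorem exists_rotPerm_eq (f : Equiv.Perm (Fin n × Fin k)) (hf : ∀ x, (f x).2 = x.2) :
    ∃ π, rotPerm π = f := by
  have hinj : ∀ t, Function.Injective (fun a => (f (a, t)).1) := by
    intro t a b hab
    have : f (a, t) = f (b, t) := Prod.ext hab (by rw [hf, hf])
    simpa using f.injective this
  refine ⟨fun t => Equiv.ofBijective _ (Finite.injective_iff_bijective.1 (hinj t)), ?_⟩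
  ext1 x
  exact Prod.ext rfl (hf x).symm

theorem rotPerm_injective {π π' : Fin k → Equiv.Perm (Fin n)} (h : rotPerm π = rotPerm π') :
    π = π' := by
  funext t
  ext1 a
  exact congrArg Prod.fst (congrArg (fun f => f (a, t)) h)

theorem tourPerm_injective {π π' : Fin k → Equiv.Perm (Fin n)} (h : tourPerm π = tourPerm π') :
    π = π' :=
  rotPerm_injective (inv_injective (mul_right_cancel h))

theorem exists_rotPerm_eq_of_isRotation {φ : (t : Fin k) → Fin n → Fin (p t)}
    {σ : Equiv.Perm (Fin n × Fin k)} (h : IsRotation (edgeSrc φ) σ) : ∃ π, rotPerm π = σ :=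
  exists_rotPerm_eq σ fun x => congrArg Sigma.fst
    ((h (σ x) x).1 (Equiv.Perm.sameCycle_apply_left.2 (Equiv.Perm.SameCycle.refl σ x)))

/-- In a tour, the successor of `x` and the shift of `x` have the same origin, hence the same type.
So `shiftPerm n k * τ⁻¹` preserves types and is some `rotPerm π`: every abstract tour is a
white-face walk. -/
theorem exists_tourPerm_eq_of_isTour {φ : (t : Fin k) → Fin n → Fin (p t)}
    {τ : Equiv.Perm (Fin n × Fin k)} (h : IsTour (edgeSrc φ) (shiftPerm n k) τ) :
    ∃ π, tourPerm π = τ := by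
  obtain ⟨π, hπ⟩ := exists_rotPerm_eq (shiftPerm n k * τ⁻¹) fun x => by
    have := congrArg Sigma.fst (h.src_apply (τ⁻¹ x))
    rw [apply_inv_apply] at this
    exact this.symm
  refine ⟨π, ?_⟩
  rw [tourPerm, hπ]
  group

theorem isConnectedTuple_of_isTour {φ : (t : Fin k) → Fin n → Fin (p t)}
    {π : Fin k → Equiv.Perm (Fin n)} (h : IsTour (edgeSrc φ) (shiftPerm n k) (tourPerm π)) :
    IsConnectedTuple π := by
  intro P h1 h2 x y hx
  have key : ∀ x, P (tourPerm π x) = P x := by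
    rintro ⟨a, t⟩
    rw [tourPerm_apply, ← h2, apply_inv_apply, ← h1]
  rwa [← eq_of_sameCycle key (h.sameCycle x y)]

/-- An invariant predicate depends only on the origin of the edge, and it propagates along the tree
paths to the root vertex. -/
theorem isConnectedTuple_of_isOutTree {φ : (t : Fin k) → Fin n → Fin (p t)}
    {π : Fin k → Equiv.Perm (Fin n)} {e₀ : Fin n × Fin k} {A : Set (Fin n × Fin k)}
    (hσ : IsRotation (edgeSrc φ) (rotPerm π))
    (hA : IsOutTree (edgeSrc φ) (shiftPerm n k) (edgeSrc φ e₀) A) : IsConnectedTuple π := by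
  intro P h1 h2
  have hsrc : ∀ x y, edgeSrc φ x = edgeSrc φ y → P x = P y := fun x y hxy =>
    eq_of_sameCycle (fun x => propext (h2 x.1 x.2)) ((hσ x y).2 hxy)
  have key : ∀ v, ∀ x, edgeSrc φ x = v → P x = P e₀ := by
    intro v
    refine (hA.reach v).head_induction_on (fun x hx => hsrc _ _ hx) ?_
    rintro _ _ ⟨e, -, rfl, rfl⟩ - ih x hx
    rw [hsrc _ _ hx, ← ih _ rfl]
    exact propext (h1 e.1 e.2)
  intro x y hx
  rwa [key _ y rfl, ← key _ x rfl]

end EdgePermutations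

/-! ### Colours, roots and changes of coordinates -/

namespace Constellation

variable {n k : ℕ} [NeZero k] {p : Fin k → ℕ} {C D : Constellation k}
  {π π' : Fin k → Equiv.Perm (Fin n)}

namespace Chart

/-- In the chart `g`, the root is `r` and the colours of the vertices are given by `φ`. -/
structure Decorates (g : C.Chart π) (root : C.Hyperedge) (c : C.Vertex → (t : Fin k) × Fin (p t))
    (φ : (t : Fin k) → Fin n → Fin (p t)) (r : Fin n) : Prop where
  face_root : face (g.toEquiv (r, 0, true)) = root.1
  color : ∀ a t, c (vertex (g.toEquiv (a, t, true))) = ⟨t, φ t a⟩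

theorem face_inj (g : C.Chart π) {a b : Fin n} {s t : Fin k} :
    face (g.toEquiv (a, s, true)) = face (g.toEquiv (b, t, true)) ↔ a = b :=
  ⟨fun h => (g.face_invariant a b s t _ _ h).2 rfl, fun h => h ▸ g.face_true a s t⟩

theorem exists_black (g : C.Chart π) {d : C.Dart} (h : C.black (face d) = true) :
    ∃ a t, g.toEquiv (a, t, true) = d := by
  obtain ⟨⟨a, t, b⟩, rfl⟩ := g.toEquiv.surjective d
  rw [g.black] at h
  exact ⟨a, t, by rw [h]⟩

theorem exists_isOut (g : C.Chart π) {d : C.Dart} (h : IsOut d) :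
    ∃ a t, g.toEquiv (a, t, false) = d := by
  obtain ⟨⟨a, t, b⟩, rfl⟩ := g.toEquiv.surjective d
  rw [IsOut, g.black] at h
  exact ⟨a, t, by rw [h]⟩

theorem hyperedge_bijective (g : C.Chart π) : Function.Bijective (fun a : Fin n =>
    (⟨face (g.toEquiv (a, 0, true)), g.black a 0 true⟩ : C.Hyperedge)) := by
  refine ⟨fun a b hab => g.face_inj.1 (congrArg Subtype.val hab), ?_⟩
  rintro ⟨f, hf⟩
  obtain ⟨d, rfl⟩ := exists_face_eq f
  obtain ⟨a, t, rfl⟩ := g.exists_black hf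
  exact ⟨a, Subtype.ext (g.face_inj.2 rfl)⟩

theorem size_eq (g : C.Chart π) : C.size = n :=
  (Nat.card_eq_of_bijective _ g.hyperedge_bijective).symm.trans (Nat.card_fin n)

/-- The chart obtained by relabelling the hyperedges. -/
def relabel (g : C.Chart π) (h : Equiv.Perm (Fin n)) (hπ : ∀ t a, π' t (h a) = h (π t a)) :
    C.Chart π' where
  toEquiv := (Equiv.prodCongr h.symm (Equiv.refl _)).trans g.toEquiv
  rot_true a t := by
    have hinv : h.symm ((π' t)⁻¹ a) = (π t)⁻¹ (h.symm a) := by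
      rw [Equiv.symm_apply_eq, Equiv.Perm.inv_eq_iff_eq, hπ, apply_inv_apply,
        Equiv.apply_symm_apply]
    simp only [Equiv.trans_apply, Equiv.prodCongr_apply, Prod.map_apply, Equiv.refl_apply, hinv]
    exact g.rot_true _ t
  rot_false a t := g.rot_false _ t
  opp_false a t := g.opp_false _ t
  black a t b := g.black _ t b
  typ a t b := g.typ _ t b

theorem relabel_apply (g : C.Chart π) (h : Equiv.Perm (Fin n))
    (hπ : ∀ t a, π' t (h a) = h (π t a)) (a : Fin n) (t : Fin k) (b : Bool) :
    (g.relabel h hπ).toEquiv (h a, t, b) = g.toEquiv (a, t, b) := by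
  simp [relabel]

/-- The image of a chart under an isomorphism. -/
def map (g : C.Chart π) (f : Iso C D) : D.Chart π where
  toEquiv := g.toEquiv.trans f.toEquiv
  rot_true a t := by simp only [Equiv.trans_apply, ← f.map_rot, g.rot_true]
  rot_false a t := by simp only [Equiv.trans_apply, ← f.map_rot, g.rot_false]
  opp_false a t := by simp only [Equiv.trans_apply, ← f.map_opp, g.opp_false]
  black a t b := by simp only [Equiv.trans_apply, f.map_black, g.black]
  typ a t b := by simp only [Equiv.trans_apply, f.map_typ, g.typ]

/-- Constellations having charts with the same permutations are isomorphic. -/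
def iso (g : C.Chart π) (g' : D.Chart π) : Iso C D where
  toEquiv := g.toEquiv.symm.trans g'.toEquiv
  map_rot d := by
    obtain ⟨⟨a, t, _ | _⟩, rfl⟩ := g.toEquiv.surjective d
    · simp only [Equiv.trans_apply, Equiv.symm_apply_apply, g.rot_false, g'.rot_false]
    · simp only [Equiv.trans_apply, Equiv.symm_apply_apply, g.rot_true, g'.rot_true]
  map_opp d := by
    obtain ⟨⟨a, t, _ | _⟩, rfl⟩ := g.toEquiv.surjective d
    · simp only [Equiv.trans_apply, Equiv.symm_apply_apply, g.opp_false, g'.opp_false]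
    · obtain ⟨t, rfl⟩ : ∃ t', t = t' + 1 := ⟨t - 1, by simp⟩
      simp only [Equiv.trans_apply, Equiv.symm_apply_apply, g.opp_true, g'.opp_true]
  map_black d := by
    obtain ⟨⟨a, t, b⟩, rfl⟩ := g.toEquiv.surjective d
    simp only [Equiv.trans_apply, Equiv.symm_apply_apply, g.black, g'.black]
  map_typ d := by
    obtain ⟨⟨a, t, b⟩, rfl⟩ := g.toEquiv.surjective d
    simp only [Equiv.trans_apply, Equiv.symm_apply_apply, g.typ, g'.typ]

theorem iso_apply (g : C.Chart π) (g' : D.Chart π) (x : Fin n × Fin k × Bool) :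
    (g.iso g').toEquiv (g.toEquiv x) = g'.toEquiv x := by
  simp [iso]

/-- Charts match half-edges with the same type and colour of the left face, so only the hyperedge
label can change; walking around the hyperedge shows that the change does not depend on the type. -/
theorem exists_relabel (g : C.Chart π) (g' : C.Chart π') :
    ∃ h : Equiv.Perm (Fin n), (∀ a t b, g'.toEquiv (h a, t, b) = g.toEquiv (a, t, b)) ∧
      ∀ t a, π' t (h a) = h (π t a) := by
  have hex : ∀ a t, ∃ a', g'.toEquiv (a', t, true) = g.toEquiv (a, t, true) := by
    intro a t
    obtain ⟨a', t', h⟩ := g'.exists_black (g.black a t true)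
    obtain rfl : t' = t := by rw [← g'.typ a' t' true, h, g.typ]
    exact ⟨a', h⟩
  choose H hH using hex
  have hconst : ∀ a t, H a t = H a 0 := by
    intro a t
    refine fin_forall_of_of_add_one (P := fun t => H a t = H a 0) (fun t ht => ?_) rfl t
    have h1 := congrArg C.facePerm (hH a (t + 1))
    rw [g.facePerm_true, g'.facePerm_true, ← hH a t, g'.toEquiv.injective.eq_iff] at h1
    rw [← ht]
    exact (congrArg Prod.fst h1).symm
  have htrue : ∀ a t, g'.toEquiv (H a 0, t, true) = g.toEquiv (a, t, true) := fun a t => by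
    rw [← hconst a t, hH]
  have hall : ∀ a t b, g'.toEquiv (H a 0, t, b) = g.toEquiv (a, t, b) := by
    rintro a t (_ | _)
    · apply C.rot.injective
      rw [g'.rot_false, g.rot_false, htrue]
    · exact htrue a t
  have hinj : Function.Injective (fun a => H a 0) := by
    intro a b hab
    have h1 := htrue a 0
    rw [show H a 0 = H b 0 from hab, htrue, g.toEquiv.injective.eq_iff] at h1
    exact (congrArg Prod.fst h1).symm
  refine ⟨Equiv.ofBijective _ (Finite.injective_iff_bijective.1 hinj), hall, fun t a => ?_⟩
  have h1 := g.rot_true (π t a) t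
  rw [inv_apply_apply, ← hall, ← hall, g'.rot_true, g'.toEquiv.injective.eq_iff] at h1
  have h2 := congrArg Prod.fst h1
  exact (Equiv.Perm.inv_eq_iff_eq.1 h2).symm

theorem Decorates.relabel {g : C.Chart π} {root : C.Hyperedge}
    {c : C.Vertex → (t : Fin k) × Fin (p t)} {φ φ' : (t : Fin k) → Fin n → Fin (p t)} {r r' : Fin n}
    (hg : g.Decorates root c φ r) {h : Equiv.Perm (Fin n)} {g' : C.Chart π'}
    (hg' : ∀ a t b, g'.toEquiv (h a, t, b) = g.toEquiv (a, t, b))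
    (hφ : ∀ t a, φ' t (h a) = φ t a) (hr : r' = h r) : g'.Decorates root c φ' r' where
  face_root := by rw [hr, hg', hg.face_root]
  color a t := by
    obtain ⟨a, rfl⟩ := h.surjective a
    rw [hg', hg.color, hφ]

theorem Decorates.eq_of_relabel {g : C.Chart π} {root : C.Hyperedge}
    {c : C.Vertex → (t : Fin k) × Fin (p t)} {φ φ' : (t : Fin k) → Fin n → Fin (p t)} {r r' : Fin n}
    (hg : g.Decorates root c φ r) {h : Equiv.Perm (Fin n)} {g' : C.Chart π'}
    (hg' : ∀ a t b, g'.toEquiv (h a, t, b) = g.toEquiv (a, t, b))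
    (hd : g'.Decorates root c φ' r') : (∀ t a, φ' t (h a) = φ t a) ∧ r' = h r := by
  refine ⟨fun t a => ?_, ?_⟩
  · have h1 := hg.color a t
    rw [← hg', hd.color] at h1
    exact eq_of_heq (Sigma.mk.inj h1).2
  · have h1 := hg.face_root
    rw [← hg', ← hd.face_root, g'.face_inj] at h1
    exact h1.symm

theorem Decorates.color_all {g : C.Chart π} {root : C.Hyperedge}
    {c : C.Vertex → (t : Fin k) × Fin (p t)} {φ : (t : Fin k) → Fin n → Fin (p t)} {r : Fin n}
    (hg : g.Decorates root c φ r) (a : Fin n) (t : Fin k) (b : Bool) :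
    c (vertex (g.toEquiv (a, t, b))) = edgeSrc φ (a, t) := by
  rw [g.vertex_eq_true, hg.color]
  rfl

theorem Decorates.edgeSrc_surjective {g : C.Chart π} {root : C.Hyperedge}
    {c : C.Vertex → (t : Fin k) × Fin (p t)} {φ : (t : Fin k) → Fin n → Fin (p t)} {r : Fin n}
    (hg : g.Decorates root c φ r) (hc : Function.Surjective c) :
    Function.Surjective (edgeSrc φ) := by
  intro v
  obtain ⟨w, rfl⟩ := hc v
  obtain ⟨a, t, rfl⟩ := g.exists_vertex w
  exact ⟨(a, t), (hg.color a t).symm⟩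

theorem Decorates.perm_color {g : C.Chart π} {root : C.Hyperedge}
    {c : C.Vertex → (t : Fin k) × Fin (p t)} {φ : (t : Fin k) → Fin n → Fin (p t)} {r : Fin n}
    (hg : g.Decorates root c φ r) (t : Fin k) (a : Fin n) : φ t (π t a) = φ t a := by
  have h1 := hg.color (π t a) t
  rw [g.vertex_perm, hg.color] at h1
  exact (eq_of_heq (Sigma.mk.inj h1).2).symm

theorem Decorates.edgeCount_eq {g : C.Chart π} {root : C.Hyperedge}
    {c : C.Vertex → (t : Fin k) × Fin (p t)} {φ : (t : Fin k) → Fin n → Fin (p t)} {r : Fin n}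
    (hg : g.Decorates root c φ r) (t : Fin k) (i : Fin (p t)) (j : Fin (p (t + 1))) :
    edgeCount c t i j = Nat.card {a // φ t a = i ∧ φ (t + 1) a = j} := by
  have hout : ∀ a t, IsOut (g.toEquiv (a, t, false)) := fun a t => g.black a t false
  symm
  refine Nat.card_eq_of_bijective (fun a => ⟨edge (g.toEquiv (a.1, t, false)),
    g.toEquiv (a.1, t, false), rfl, hout _ _, ?_, ?_⟩) ⟨?_, ?_⟩
  · rw [hg.color_all, edgeSrc, a.2.1]
  · rw [g.opp_false, hg.color_all, edgeSrc, a.2.2]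
  · intro a b hab
    exact Subtype.ext (g.edge_inj (congrArg Subtype.val hab)).1
  · rintro ⟨e, d, rfl, hd, h1, h2⟩
    obtain ⟨a, s, rfl⟩ := g.exists_isOut hd
    rw [hg.color_all] at h1
    obtain rfl : s = t := congrArg Sigma.fst h1
    rw [g.opp_false, hg.color_all] at h2
    exact ⟨⟨a, eq_of_heq (Sigma.mk.inj h1).2, eq_of_heq (Sigma.mk.inj h2).2⟩, rfl⟩

end Chart

theorem exists_decorated_chart {root : C.Hyperedge} {c : C.Vertex → (t : Fin k) × Fin (p t)}
    (hc : ∀ v, (c v).1 = C.typ v) (l : C.Hyperedge ≃ Fin n) :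
    ∃ π φ, ∃ g : C.Chart π, g.Decorates root c φ (l root) ∧
      ∀ a t h, l (hyperedge (g.toEquiv (a, t, true)) h) = a := by
  obtain ⟨π, g, hg⟩ := exists_chart l
  have hex : ∀ t a, ∃ i, c (vertex (g.toEquiv (a, t, true))) = ⟨t, i⟩ := by
    intro t a
    have h1 := hc (vertex (g.toEquiv (a, t, true)))
    rw [g.typ] at h1
    rcases h2 : c (vertex (g.toEquiv (a, t, true))) with ⟨s, i⟩
    rw [h2] at h1
    obtain rfl : s = t := h1
    exact ⟨i, rfl⟩
  choose φ hφ using hex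
  refine ⟨π, φ, g, ⟨?_, fun a t => hφ t a⟩, hg⟩
  exact congrArg Subtype.val (l.injective (hg (l root) 0 (g.black _ _ _)))

end Constellation

/-! ### White faces and arborescences in coordinates -/

namespace Constellation

namespace Chart

variable {n k : ℕ} [NeZero k] {p : Fin k → ℕ} {C : Constellation k}
  {π : Fin k → Equiv.Perm (Fin n)} {root : C.Hyperedge} {c : C.Vertex → (t : Fin k) × Fin (p t)}
  {φ : (t : Fin k) → Fin n → Fin (p t)} {r : Fin n}

/-! ### White faces -/

theorem facePerm_pow_false (g : C.Chart π) (x : Fin n × Fin k) (i : ℕ) :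
    (C.facePerm ^ i) (g.toEquiv (x.1, x.2, false)) =
      g.toEquiv (((tourPerm π ^ i) x).1, ((tourPerm π ^ i) x).2, false) := by
  induction i with
  | zero => rfl
  | succ i ih =>
    rw [pow_succ', pow_succ', Equiv.Perm.mul_apply, Equiv.Perm.mul_apply, ih, g.facePerm_false]
    rfl

/-- On half-edges with a white face on the left, `facePerm` acts as `tourPerm π`, so white faces are
its cycles. The element `r` provides a white face. -/
theorem card_whiteFace_eq_one_iff (g : C.Chart π) (r : Fin n) :
    Nat.card C.WhiteFace = 1 ↔ ∀ x y, (tourPerm π).SameCycle x y := by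
  have hfin := C.finite_dart
  have hw : ∀ x : Fin n × Fin k, C.black (face (g.toEquiv (x.1, x.2, false))) = false :=
    fun x => g.black _ _ _
  have hcyc : ∀ x y : Fin n × Fin k, face (g.toEquiv (x.1, x.2, false)) =
      face (g.toEquiv (y.1, y.2, false)) ↔ (tourPerm π).SameCycle x y := by
    intro x y
    rw [face_eq_iff]
    constructor
    · intro h
      obtain ⟨i, hi⟩ := h.exists_nat_pow_eq
      rw [g.facePerm_pow_false, g.toEquiv.injective.eq_iff, Prod.mk.injEq, Prod.mk.injEq] at hi
      exact ⟨i, by rw [zpow_natCast]; exact Prod.ext hi.1 hi.2.1⟩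
    · intro h
      obtain ⟨i, rfl⟩ := h.exists_nat_pow_eq
      exact ⟨i, by rw [zpow_natCast, g.facePerm_pow_false]⟩
  rw [Nat.card_eq_one_iff_unique]
  constructor
  · rintro ⟨h, -⟩ x y
    rw [← hcyc]
    exact congrArg Subtype.val
      (h.elim (⟨_, hw x⟩ : {f : C.Face // C.black f = false}) ⟨_, hw y⟩)
  · intro h
    refine ⟨⟨?_⟩, ⟨⟨_, hw (r, 0)⟩⟩⟩
    rintro ⟨f, hf⟩ ⟨f', hf'⟩
    obtain ⟨d, rfl⟩ := exists_face_eq f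
    obtain ⟨d', rfl⟩ := exists_face_eq f'
    obtain ⟨a, t, rfl⟩ := g.exists_isOut hf
    obtain ⟨a', t', rfl⟩ := g.exists_isOut hf'
    exact Subtype.ext ((hcyc (a, t) (a', t')).2 (h _ _))

theorem Decorates.isTour {g : C.Chart π} (hg : g.Decorates root c φ r)
    (h : Nat.card C.WhiteFace = 1) : IsTour (edgeSrc φ) (shiftPerm n k) (tourPerm π) where
  src_apply := by
    rintro ⟨a, t⟩
    rw [tourPerm_apply, shiftPerm_apply, edgeSrc, edgeSrc]
    congr 1
    rw [← hg.perm_color, apply_inv_apply]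
  sameCycle := (g.card_whiteFace_eq_one_iff r).1 h

/-! ### Arborescences -/

/-- The cycles of `rotPerm π` are the vertices, and an injective labelling identifies vertices with
labels. -/
theorem Decorates.isRotation {g : C.Chart π} (hg : g.Decorates root c φ r)
    (hc : Function.Injective c) : IsRotation (edgeSrc φ) (rotPerm π) := by
  rintro ⟨a, t⟩ ⟨b, s⟩
  constructor
  · refine eq_of_sameCycle ?_
    rintro ⟨a, t⟩
    rw [rotPerm_apply, edgeSrc, edgeSrc]
    congr 1
    exact hg.perm_color t a
  · intro h
    obtain rfl : t = s := congrArg Sigma.fst h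
    rw [sameCycle_rotPerm]
    apply g.vertex_sameCycle
    apply hc
    rw [hg.color_all, hg.color_all, h]

theorem Decorates.adjIn_iff {g : C.Chart π} (hg : g.Decorates root c φ r)
    (hc : Function.Injective c) {T : Set C.Edge} {A : Set (Fin n × Fin k)}
    (hT : ∀ a t, edge (g.toEquiv (a, t, false)) ∈ T ↔ (a, t) ∈ A) (u v : C.Vertex) :
    AdjIn T u v ↔ Joined (edgeSrc φ) (shiftPerm n k) A (c u) (c v) := by
  constructor
  · rintro ⟨d, hd, rfl, rfl⟩
    obtain ⟨⟨a, t, _ | _⟩, rfl⟩ := g.toEquiv.surjective d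
    · refine ⟨(a, t), (hT a t).1 hd, Or.inl ⟨(hg.color_all _ _ _).symm, ?_⟩⟩
      rw [g.opp_false, hg.color_all]
      rfl
    · obtain ⟨t, rfl⟩ : ∃ t', t = t' + 1 := ⟨t - 1, by simp⟩
      rw [← edge_opp, g.opp_true] at hd
      refine ⟨(a, t), (hT a t).1 hd, Or.inr ⟨(hg.color_all _ _ _).symm, ?_⟩⟩
      rw [g.opp_true, hg.color_all]
  · rintro ⟨⟨a, t⟩, he, ⟨h1, h2⟩ | ⟨h1, h2⟩⟩
    · refine ⟨g.toEquiv (a, t, false), (hT a t).2 he, hc ?_, hc ?_⟩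
      · rw [hg.color_all, h1]
      · rw [g.opp_false, hg.color_all, ← h2]
        rfl
    · refine ⟨g.toEquiv (a, t + 1, true), ?_, hc ?_, hc ?_⟩
      · rw [← edge_opp, g.opp_true]
        exact (hT a t).2 he
      · rw [hg.color_all, ← h1]
        rfl
      · rw [g.opp_true, hg.color_all, h2]

theorem Decorates.reflTransGen_adjIn_iff {g : C.Chart π} (hg : g.Decorates root c φ r)
    (hc : Function.Bijective c) {T : Set C.Edge} {A : Set (Fin n × Fin k)}
    (hT : ∀ a t, edge (g.toEquiv (a, t, false)) ∈ T ↔ (a, t) ∈ A) (u v : C.Vertex) :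
    Relation.ReflTransGen (AdjIn T) u v ↔
      Relation.ReflTransGen (Joined (edgeSrc φ) (shiftPerm n k) A) (c u) (c v) := by
  refine ⟨fun h => h.lift c fun _ _ => (hg.adjIn_iff hc.1 hT _ _).1, fun h => ?_⟩
  let l := Equiv.ofBijective c hc
  have h1 := h.lift l.symm (p := AdjIn T) fun x y hxy => by
    rw [Function.onFun, hg.adjIn_iff hc.1 hT]
    change Joined _ _ _ (l (l.symm x)) (l (l.symm y))
    rwa [l.apply_symm_apply, l.apply_symm_apply]
  change Relation.ReflTransGen (AdjIn T) (l.symm (l u)) (l.symm (l v)) at h1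
  rwa [l.symm_apply_apply, l.symm_apply_apply] at h1

theorem hasType_isEnd_iff (g : C.Chart π) (a : Fin n) (t : Fin k) (v : C.Vertex) :
    HasType (edge (g.toEquiv (a, t, false))) (C.typ v) ∧ IsEnd v (edge (g.toEquiv (a, t, false))) ↔
      vertex (g.toEquiv (a, t, true)) = v := by
  constructor
  · rintro ⟨⟨d, hd, hd', ht⟩, d', hd'', rfl⟩
    obtain ⟨a', t', rfl⟩ := g.exists_isOut hd'
    obtain ⟨rfl, rfl⟩ := g.edge_inj hd
    rw [g.typ] at ht
    rcases edge_eq_edge hd'' with h | h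
    · rw [← h, g.vertex_false]
    -- The far end of an edge of type `t` has type `t + 1`, which equals `t` only for `k = 1`; then
    -- the edge is a loop and both ends agree.
    · have h2 : d' = g.toEquiv (a', t' + 1, true) := by
        rw [← g.opp_false, h, C.opp_opp]
      rw [h2, g.typ] at ht
      rw [h2, ← ht]
  · rintro rfl
    refine ⟨⟨_, rfl, g.black _ _ _, by rw [g.typ, g.typ]⟩, _, rfl, g.vertex_false a t⟩

/-- Among the edges at a vertex of type `t`, those of type `t` are the ones leaving it. So the
arborescence condition says that each vertex other than `v₀` has exactly one outgoing tree edge, and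
the lemmas on spanning trees apply in both directions. -/
theorem Decorates.isArborescence_iff {g : C.Chart π} (hg : g.Decorates root c φ r)
    (hc : Function.Bijective c) {T : Set C.Edge} {A : Set (Fin n × Fin k)}
    (hT : ∀ a t, edge (g.toEquiv (a, t, false)) ∈ T ↔ (a, t) ∈ A) (e₀ : Fin n × Fin k) :
    IsArborescence (vertex (g.toEquiv (e₀.1, e₀.2, true))) T ↔
      IsOutTree (edgeSrc φ) (shiftPerm n k) (edgeSrc φ e₀) A := by
  have hT' : ∀ x : Fin n × Fin k, ∀ a t, edge (g.toEquiv (a, t, false)) ∈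
      T \ {edge (g.toEquiv (x.1, x.2, false))} ↔ (a, t) ∈ A \ {x} := by
    rintro ⟨b, s⟩ a t
    rw [Set.mem_sdiff, Set.mem_sdiff, hT]
    refine and_congr_right fun _ => not_congr ?_
    constructor
    · intro h
      obtain ⟨rfl, rfl⟩ := g.edge_inj h
      rfl
    · intro h
      obtain ⟨rfl, rfl⟩ := Prod.mk.inj h
      rfl
  have hv₀ : c (vertex (g.toEquiv (e₀.1, e₀.2, true))) = edgeSrc φ e₀ := hg.color_all _ _ _
  have hsrc : ∀ x : Fin n × Fin k, c (vertex (g.toEquiv (x.1, x.2, false))) = edgeSrc φ x :=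
    fun x => hg.color_all _ _ _
  have htgt : ∀ x : Fin n × Fin k, c (vertex (C.opp (g.toEquiv (x.1, x.2, false)))) =
      edgeSrc φ (shiftPerm n k x) := fun x => by
    rw [g.opp_false, hg.color_all]
    rfl
  have hend : ∀ (x : Fin n × Fin k) v, HasType (edge (g.toEquiv (x.1, x.2, false))) (C.typ v) ∧
      IsEnd v (edge (g.toEquiv (x.1, x.2, false))) ↔ edgeSrc φ x = c v := fun x v => by
    rw [g.hasType_isEnd_iff, ← hc.1.eq_iff, hg.color_all]
  constructor
  · rintro ⟨⟨-, hacyc⟩, hout⟩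
    have : Finite C.Vertex := by
      have := C.finite_dart
      exact Quotient.finite _
    have : Finite ((t : Fin k) × Fin (p t)) := inferInstance
    refine isOutTree_of_spanningTree (e₀ := e₀) rfl (fun x hx h => ?_) (fun v hv => ?_)
    · apply hacyc (g.toEquiv (x.1, x.2, false)) ((hT _ _).2 hx)
      rwa [hg.reflTransGen_adjIn_iff hc (hT' x), hsrc, htgt]
    · obtain ⟨w, rfl⟩ := hc.2 v
      obtain ⟨e, ⟨he, he'⟩, huniq⟩ := hout w (fun h => hv (by rw [h, hv₀]))
      obtain ⟨a, t, rfl⟩ := g.exists_edge e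
      refine ⟨(a, t), ⟨(hT a t).1 he, (hend (a, t) w).1 he'⟩, ?_⟩
      rintro ⟨b, s⟩ ⟨hx, hx'⟩
      have h1 := huniq _ ⟨(hT b s).2 hx, (hend (b, s) w).2 hx'⟩
      obtain ⟨rfl, rfl⟩ := g.edge_inj h1
      rfl
  · intro hA
    refine ⟨⟨fun u v => ?_, fun d hd h => ?_⟩, fun v hv => ?_⟩
    · rw [hg.reflTransGen_adjIn_iff hc hT]
      exact hA.reflTransGen_joined _ _
    · obtain ⟨a, t, h1⟩ := g.exists_edge (edge d)
      rw [← h1, hg.reflTransGen_adjIn_iff hc (hT' (a, t))] at h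
      rw [← h1] at hd
      apply hA.acyclic ((hT a t).1 hd)
      rw [← hsrc, ← htgt]
      rcases edge_eq_edge h1 with h2 | h2
      · rwa [h2] at h
      · rw [h2, C.opp_opp] at h
        exact reflTransGen_joined_symm h
    · obtain ⟨x, hx, hx'⟩ := hA.exists_mem (c v) (fun h => hv (hc.1 (h.trans hv₀.symm)))
      refine ⟨edge (g.toEquiv (x.1, x.2, false)), ⟨(hT _ _).2 hx, (hend x v).2 hx'⟩, ?_⟩
      rintro e ⟨he, he'⟩
      obtain ⟨b, s, rfl⟩ := g.exists_edge e
      rw [← hA.unique _ ((hT b s).1 he) x hx (((hend (b, s) v).1 he').trans hx'.symm)]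

theorem Decorates.eq_of_isRootVertex {g : C.Chart π} (hg : g.Decorates root c φ r) {v : C.Vertex} :
    IsRootVertex root v ↔ v = vertex (g.toEquiv (r, lastType k, true)) := by
  constructor
  · rintro ⟨hv, d, hd, rfl⟩
    obtain ⟨a, t, rfl⟩ := g.exists_black (d := d) (by rw [hd]; exact root.2)
    rw [g.typ] at hv
    rw [← hg.face_root, g.face_inj] at hd
    rw [hv, hd]
  · rintro rfl
    exact ⟨g.typ _ _ _, _, (g.face_inj.2 rfl).trans hg.face_root, rfl⟩

end Chart

end Constellation

/-! ### Cacti and tree-rooted constellations as data up to relabelling -/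

section Data

variable {n k : ℕ} [NeZero k] {p : Fin k → ℕ} {π π' ρ ρ' : Fin k → Equiv.Perm (Fin n)}
  {φ φ' : (t : Fin k) → Fin n → Fin (p t)} {r r' : Fin n} {A A' : Set (Fin n × Fin k)}

/-- The coloured rooted cactus `C` is given by the permutations `π`, the colouring `φ` and the root
`r`. -/
def CactusData.IsModel (C : CactusData n p) (π : Fin k → Equiv.Perm (Fin n))
    (φ : (t : Fin k) → Fin n → Fin (p t)) (r : Fin n) : Prop :=
  ∃ g : C.toConstellation.Chart π, g.Decorates C.root C.color φ r

/-- The tree-rooted constellation `T` is given by the permutations `ρ`, the labelling `φ`, the root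
`r` and the set of edges `A`. -/
def TreeRootedData.IsModel (T : TreeRootedData n p) (ρ : Fin k → Equiv.Perm (Fin n))
    (φ : (t : Fin k) → Fin n → Fin (p t)) (r : Fin n) (A : Set (Fin n × Fin k)) : Prop :=
  ∃ g : T.toConstellation.Chart ρ, g.Decorates T.root T.label φ r ∧
    ∀ a t, edge (g.toEquiv (a, t, false)) ∈ T.tree ↔ (a, t) ∈ A

/-- The permutation `h` of the hyperedges sends the first data to the second ones. -/
structure IsRelabelling (h : Equiv.Perm (Fin n)) (π : Fin k → Equiv.Perm (Fin n))
    (φ : (t : Fin k) → Fin n → Fin (p t)) (r : Fin n) (π' : Fin k → Equiv.Perm (Fin n))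
    (φ' : (t : Fin k) → Fin n → Fin (p t)) (r' : Fin n) : Prop where
  perm : ∀ t a, π' t (h a) = h (π t a)
  color : ∀ t a, φ' t (h a) = φ t a
  root : r' = h r

noncomputable def hyperedgeEquiv {C : Constellation k} (h : C.size = n) : C.Hyperedge ≃ Fin n :=
  have : Finite C.Hyperedge := by
    have := C.finite_dart
    have : Finite C.Face := Quotient.finite _
    exact Subtype.finite
  Finite.equivFinOfCardEq h

namespace CactusData

theorem exists_isModel (C : CactusData n p) : ∃ π φ r, C.IsModel π φ r := by
  obtain ⟨π, φ, g, hg, -⟩ := exists_decorated_chart (root := C.root) C.color_fst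
    (hyperedgeEquiv C.size_eq)
  exact ⟨π, φ, _, g, hg⟩

theorem IsModel.isTour {C : CactusData n p} (h : C.IsModel π φ r) :
    IsTour (edgeSrc φ) (shiftPerm n k) (tourPerm π) := by
  obtain ⟨g, hg⟩ := h
  exact hg.isTour C.card_white

theorem IsModel.edgeSrc_surjective {C : CactusData n p} (h : C.IsModel π φ r) :
    Function.Surjective (edgeSrc φ) := by
  obtain ⟨g, hg⟩ := h
  exact hg.edgeSrc_surjective C.color_surjective

theorem IsModel.relabel {C : CactusData n p} (hC : C.IsModel π φ r) {h : Equiv.Perm (Fin n)}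
    (hh : IsRelabelling h π φ r π' φ' r') : C.IsModel π' φ' r' := by
  obtain ⟨g, hg⟩ := hC
  exact ⟨g.relabel h hh.perm, hg.relabel (g.relabel_apply h hh.perm) hh.color hh.root⟩

theorem IsModel.exists_relabelling {C : CactusData n p} (hC : C.IsModel π φ r)
    (hC' : C.IsModel π' φ' r') : ∃ h, IsRelabelling h π φ r π' φ' r' := by
  obtain ⟨g, hg⟩ := hC
  obtain ⟨g', hg'⟩ := hC'
  obtain ⟨h, h1, h2⟩ := g.exists_relabel g'
  obtain ⟨h3, h4⟩ := hg.eq_of_relabel h1 hg'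
  exact ⟨h, h2, h3, h4⟩

theorem IsModel.equiv {C D : CactusData n p} (hC : C.IsModel π φ r) (hD : D.IsModel π φ r) :
    C ≈ D := by
  obtain ⟨g, hg⟩ := hC
  obtain ⟨g', hg'⟩ := hD
  refine ⟨g.iso g', fun d => ?_, fun d => ?_⟩
  · obtain ⟨⟨a, t, b⟩, rfl⟩ := g.toEquiv.surjective d
    rw [g.iso_apply, ← hg.face_root, ← hg'.face_root]
    cases b
    · exact ⟨fun h => absurd (g'.face_invariant _ _ _ _ _ _ h).1 (by simp),
        fun h => absurd (g.face_invariant _ _ _ _ _ _ h).1 (by simp)⟩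
    · rw [g.face_inj, g'.face_inj]
  · obtain ⟨⟨a, t, b⟩, rfl⟩ := g.toEquiv.surjective d
    rw [g.iso_apply, hg.color_all, hg'.color_all]

theorem IsModel.congr {C D : CactusData n p} (hC : C.IsModel π φ r) (h : C ≈ D) :
    D.IsModel π φ r := by
  obtain ⟨g, hg⟩ := hC
  obtain ⟨f, h1, h2⟩ := h
  exact ⟨g.map f, (h1 _).2 hg.face_root, fun a t => (h2 _).trans (hg.color a t)⟩

theorem exists_of_isTour (h : IsTour (edgeSrc φ) (shiftPerm n k) (tourPerm π))
    (hs : Function.Surjective (edgeSrc φ)) (r : Fin n) :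
    ∃ C : CactusData n p, C.IsModel π φ r := by
  have hconn := isConnectedTuple_of_isTour h
  have hφ : ∀ t a, φ (t + 1) ((π (t + 1))⁻¹ a) = φ (t + 1) a := fun t a =>
    eq_of_heq (Sigma.mk.inj (h.src_apply (a, t))).2
  have hφ' : ∀ t a, φ t ((π t)⁻¹ a) = φ t a := fun t a => by
    have := hφ (t - 1) a
    rwa [sub_add_cancel] at this
  refine ⟨{ toConstellation := model r hconn
            size_eq := (modelChart r hconn).size_eq
            card_white := ((modelChart r hconn).card_whiteFace_eq_one_iff r).2 h.sameCycle
            root := ⟨face (M := modelMap r hconn) (r, 0, true), rfl⟩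
            color := Quotient.lift
              (fun d : Fin n × Fin k × Bool => edgeSrc φ (d.1, d.2.1)) (by
                intro d d' hd
                refine eq_of_sameCycle (f := modelRot π)
                  (F := fun d : Fin n × Fin k × Bool => edgeSrc φ (d.1, d.2.1)) ?_ hd
                rintro ⟨a, t, _ | _⟩
                · rfl
                · exact congrArg (Sigma.mk t) (hφ' t a))
            color_fst := ?_
            color_surjective := ?_ }, modelChart r hconn, rfl, fun a t => rfl⟩
  · intro v
    obtain ⟨d, rfl⟩ := exists_vertex_eq v
    rfl
  · intro v
    obtain ⟨x, rfl⟩ := hs v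
    exact ⟨vertex (M := modelMap r hconn) (x.1, x.2, true), rfl⟩

end CactusData

namespace TreeRootedData

theorem exists_isModel (T : TreeRootedData n p) : ∃ ρ φ r A, T.IsModel ρ φ r A := by
  obtain ⟨π, φ, g, hg, -⟩ := exists_decorated_chart (root := T.root) T.label_fst
    (hyperedgeEquiv T.size_eq)
  exact ⟨π, φ, _, {x | edge (g.toEquiv (x.1, x.2, false)) ∈ T.tree}, g, hg, fun a t => Iff.rfl⟩

theorem IsModel.isRotation {T : TreeRootedData n p} (h : T.IsModel ρ φ r A) :
    IsRotation (edgeSrc φ) (rotPerm ρ) := by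
  obtain ⟨g, hg, -⟩ := h
  exact hg.isRotation T.label_bijective.1

theorem IsModel.isOutTree {T : TreeRootedData n p} (h : T.IsModel ρ φ r A) :
    IsOutTree (edgeSrc φ) (shiftPerm n k) (edgeSrc φ (r, lastType k)) A := by
  obtain ⟨g, hg, hA⟩ := h
  obtain ⟨v, hv, hv'⟩ := T.tree_arborescence
  rw [hg.eq_of_isRootVertex] at hv
  rw [hv] at hv'
  exact (hg.isArborescence_iff T.label_bijective hA (r, lastType k)).1 hv'

theorem IsModel.edgeSrc_surjective {T : TreeRootedData n p} (h : T.IsModel ρ φ r A) :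
    Function.Surjective (edgeSrc φ) := by
  obtain ⟨g, hg, -⟩ := h
  exact hg.edgeSrc_surjective T.label_bijective.2

theorem IsModel.relabel {T : TreeRootedData n p} (hT : T.IsModel ρ φ r A) {h : Equiv.Perm (Fin n)}
    (hh : IsRelabelling h ρ φ r ρ' φ' r') (hA : ∀ a t, (h a, t) ∈ A' ↔ (a, t) ∈ A) :
    T.IsModel ρ' φ' r' A' := by
  obtain ⟨g, hg, hgA⟩ := hT
  refine ⟨g.relabel h hh.perm, hg.relabel (g.relabel_apply h hh.perm) hh.color hh.root, ?_⟩
  intro a t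
  obtain ⟨a, rfl⟩ := h.surjective a
  rw [g.relabel_apply, hgA, hA]

theorem IsModel.exists_relabelling {T : TreeRootedData n p} (hT : T.IsModel ρ φ r A)
    (hT' : T.IsModel ρ' φ' r' A') :
    ∃ h, IsRelabelling h ρ φ r ρ' φ' r' ∧ ∀ a t, (h a, t) ∈ A' ↔ (a, t) ∈ A := by
  obtain ⟨g, hg, hgA⟩ := hT
  obtain ⟨g', hg', hgA'⟩ := hT'
  obtain ⟨h, h1, h2⟩ := g.exists_relabel g'
  obtain ⟨h3, h4⟩ := hg.eq_of_relabel h1 hg'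
  exact ⟨h, ⟨h2, h3, h4⟩, fun a t => by rw [← hgA', h1, hgA]⟩

theorem IsModel.equiv {T U : TreeRootedData n p} (hT : T.IsModel ρ φ r A)
    (hU : U.IsModel ρ φ r A) : T ≈ U := by
  obtain ⟨g, hg, hgA⟩ := hT
  obtain ⟨g', hg', hgA'⟩ := hU
  refine ⟨g.iso g', fun d => ?_, fun d => ?_, fun d => ?_⟩
  · obtain ⟨⟨a, t, b⟩, rfl⟩ := g.toEquiv.surjective d
    rw [g.iso_apply, ← hg.face_root, ← hg'.face_root]
    cases b
    · exact ⟨fun h => absurd (g'.face_invariant _ _ _ _ _ _ h).1 (by simp),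
        fun h => absurd (g.face_invariant _ _ _ _ _ _ h).1 (by simp)⟩
    · rw [g.face_inj, g'.face_inj]
  · obtain ⟨⟨a, t, b⟩, rfl⟩ := g.toEquiv.surjective d
    rw [g.iso_apply]
    cases b
    · rw [hgA, hgA']
    · obtain ⟨t, rfl⟩ : ∃ t', t = t' + 1 := ⟨t - 1, by simp⟩
      rw [← edge_opp, g'.opp_true, ← edge_opp (g.toEquiv _), g.opp_true, hgA, hgA']
  · obtain ⟨⟨a, t, b⟩, rfl⟩ := g.toEquiv.surjective d
    rw [g.iso_apply, hg.color_all, hg'.color_all]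

theorem IsModel.congr {T U : TreeRootedData n p} (hT : T.IsModel ρ φ r A) (h : T ≈ U) :
    U.IsModel ρ φ r A := by
  obtain ⟨g, hg, hgA⟩ := hT
  obtain ⟨f, h1, h2, h3⟩ := h
  exact ⟨g.map f, ⟨(h1 _).2 hg.face_root, fun a t => (h3 _).trans (hg.color a t)⟩,
    fun a t => (h2 _).trans (hgA a t)⟩

theorem exists_of_isOutTree (hσ : IsRotation (edgeSrc φ) (rotPerm ρ))
    (hA : IsOutTree (edgeSrc φ) (shiftPerm n k) (edgeSrc φ (r, lastType k)) A)
    (hs : Function.Surjective (edgeSrc φ)) : ∃ T : TreeRootedData n p, T.IsModel ρ φ r A := by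
  have hconn := isConnectedTuple_of_isOutTree hσ hA
  have hφ : ∀ t a, edgeSrc φ ((ρ t)⁻¹ a, t) = edgeSrc φ (a, t) := fun t a => by
    rw [← hσ, sameCycle_rotPerm]
    exact ⟨1, by rw [zpow_one, apply_inv_apply]⟩
  let root : (model r hconn).Hyperedge := ⟨face (M := modelMap r hconn) (r, 0, true), rfl⟩
  let label : (model r hconn).Vertex → (t : Fin k) × Fin (p t) := Quotient.lift
    (fun d : Fin n × Fin k × Bool => edgeSrc φ (d.1, d.2.1)) (by
      intro d d' hd
      refine eq_of_sameCycle (f := modelRot ρ)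
        (F := fun d : Fin n × Fin k × Bool => edgeSrc φ (d.1, d.2.1)) ?_ hd
      rintro ⟨a, t, _ | _⟩
      · rfl
      · exact hφ t a)
  let tree : Set (model r hconn).Edge :=
    {e | ∃ x ∈ A, edge (M := modelMap r hconn) (x.1, x.2, false) = e}
  let g := modelChart r hconn
  have hg : g.Decorates root label φ r := ⟨rfl, fun a t => rfl⟩
  have htree : ∀ a t, edge (g.toEquiv (a, t, false)) ∈ tree ↔ (a, t) ∈ A := by
    intro a t
    constructor
    · rintro ⟨⟨b, s⟩, hx, h⟩
      obtain ⟨rfl, rfl⟩ := g.edge_inj h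
      exact hx
    · intro h
      exact ⟨_, h, rfl⟩
  have hlabel : Function.Bijective label := by
    constructor
    · intro u v huv
      obtain ⟨a, t, rfl⟩ := g.exists_vertex u
      obtain ⟨b, s, rfl⟩ := g.exists_vertex v
      rw [hg.color_all, hg.color_all] at huv
      obtain rfl : t = s := congrArg Sigma.fst huv
      apply g.vertex_eq_of_sameCycle
      rwa [← sameCycle_rotPerm, hσ]
    · intro v
      obtain ⟨x, rfl⟩ := hs v
      exact ⟨vertex (g.toEquiv (x.1, x.2, true)), rfl⟩
  refine ⟨{ toConstellation := model r hconn
            size_eq := g.size_eq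
            root := root
            tree := tree
            tree_arborescence := ⟨_, hg.eq_of_isRootVertex.2 rfl,
              (hg.isArborescence_iff hlabel htree (r, lastType k)).2 hA⟩
            label := label
            label_fst := ?_
            label_bijective := hlabel }, g, hg, htree⟩
  intro v
  obtain ⟨d, rfl⟩ := exists_vertex_eq v
  rfl

end TreeRootedData

end Data

/-! ### One white face and products equal to a long cycle -/

section Products

set_option linter.unusedSectionVars false

variable {n k : ℕ} [NeZero k] {p : Fin k → ℕ} {π : Fin k → Equiv.Perm (Fin n)}

theorem fin_mk_add_one {j : ℕ} (h : j + 1 < k) :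
    (⟨j, by omega⟩ : Fin k) + 1 = ⟨j + 1, h⟩ := by
  obtain ⟨m, rfl⟩ : ∃ m, k = m + 1 := ⟨k - 1, by omega⟩
  exact Fin.ext (Fin.val_add_one_of_lt (by simp only [Fin.lt_def, Fin.val_last]; omega))

theorem lastType_add_one : lastType k + 1 = ⟨0, NeZero.pos k⟩ := by
  obtain ⟨m, rfl⟩ : ∃ m, k = m + 1 := ⟨k - 1, by have := NeZero.pos k; omega⟩
  exact Fin.last_add_one m

/-- The product of the first `j` permutations. -/
def partialProd (π : Fin k → Equiv.Perm (Fin n)) (j : ℕ) : Equiv.Perm (Fin n) :=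
  ((List.ofFn π).take j).prod

theorem partialProd_zero : partialProd π 0 = 1 := by simp [partialProd]

theorem partialProd_succ {j : ℕ} (h : j < k) :
    partialProd π (j + 1) = partialProd π j * π ⟨j, h⟩ := by
  rw [partialProd, List.prod_take_succ _ _ (by simpa using h), List.getElem_ofFn]
  rfl

theorem partialProd_lastType : partialProd π (lastType k + 1) = (List.ofFn π).prod := by
  have h : ((lastType k : Fin k) : ℕ) + 1 = k := by
    have := NeZero.pos k
    simp only [lastType]
    omega
  rw [h, partialProd, List.take_of_length_le (by simp)]

theorem partialProd_tourPerm (x : Fin n × Fin k) (hx : x.2 ≠ lastType k) :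
    partialProd π ((tourPerm π x).2 + 1) (tourPerm π x).1 = partialProd π (x.2 + 1) x.1 := by
  obtain ⟨a, ⟨j, hj⟩⟩ := x
  have hj' : j + 1 < k := by
    by_contra hc
    exact hx (Fin.ext (by simp only [lastType]; omega))
  rw [tourPerm_apply, fin_mk_add_one hj', partialProd_succ hj', Equiv.Perm.mul_apply,
    apply_inv_apply]

theorem partialProd_tourPerm_lastType (a : Fin n) :
    partialProd π ((tourPerm π (a, lastType k)).2 + 1) (tourPerm π (a, lastType k)).1 = a := by
  rw [tourPerm_apply, lastType_add_one, partialProd_succ (NeZero.pos k), partialProd_zero, one_mul,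
    apply_inv_apply]

/-- Attach to the edge `(a, t)` the image of `a` under the product of the permutations up to type
`t`. Along the tour this value is constant, except that after the last type it moves one step back
along the cycle of the full product. -/
theorem sameCycle_prod_of_tourPerm (h : ∀ x y, (tourPerm π).SameCycle x y) (a b : Fin n) :
    (List.ofFn π).prod.SameCycle a b := by
  let s := Equiv.Perm.SameCycle.setoid (List.ofFn π).prod
  let F : Fin n × Fin k → Quotient s := fun x => Quotient.mk s (partialProd π (x.2 + 1) x.1)
  have hF : ∀ x, F (tourPerm π x) = F x := by
    rintro ⟨a, t⟩
    by_cases ht : t = lastType k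
    · subst ht
      simp only [F, partialProd_tourPerm_lastType, partialProd_lastType]
      exact Quotient.sound (s := s) ⟨1, by rw [zpow_one]⟩
    · simp only [F, partialProd_tourPerm (a, t) ht]
  have h1 := eq_of_sameCycle hF (h (a, lastType k) (b, lastType k))
  simp only [F, partialProd_lastType] at h1
  exact Equiv.Perm.sameCycle_apply_left.1
    (Equiv.Perm.sameCycle_apply_right.1 (Quotient.exact (s := s) h1))

/-- Every edge is followed by one of the last type, and one round of the tour acts on those by the
inverse of the full product. -/
theorem sameCycle_tourPerm_of_prod (h : ∀ a b, (List.ofFn π).prod.SameCycle a b)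
    (x y : Fin n × Fin k) : (tourPerm π).SameCycle x y := by
  have hstep : ∀ j (hj : j < k) a,
      (tourPerm π).SameCycle (a, lastType k) ((partialProd π (j + 1))⁻¹ a, ⟨j, hj⟩) := by
    intro j
    induction j with
    | zero =>
      intro hj a
      have : tourPerm π (a, lastType k) = ((partialProd π (0 + 1))⁻¹ a, ⟨0, hj⟩) := by
        rw [tourPerm_apply, lastType_add_one, partialProd_succ hj, partialProd_zero, one_mul]
      rw [← this, Equiv.Perm.sameCycle_apply_right]
    | succ j ih =>
      intro hj a
      have : tourPerm π ((partialProd π (j + 1))⁻¹ a, ⟨j, by omega⟩) =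
          ((partialProd π (j + 1 + 1))⁻¹ a, ⟨j + 1, hj⟩) := by
        rw [tourPerm_apply, fin_mk_add_one hj, partialProd_succ hj, mul_inv_rev,
          Equiv.Perm.mul_apply]
      rw [← this, Equiv.Perm.sameCycle_apply_right]
      exact ih _ a
  have hinv : ∀ a, (tourPerm π).SameCycle ((List.ofFn π).prod a, lastType k) (a, lastType k) := by
    intro a
    have := hstep (lastType k) (lastType k).2 ((List.ofFn π).prod a)
    rwa [partialProd_lastType, inv_apply_apply] at this
  let s := Equiv.Perm.SameCycle.setoid (tourPerm π)
  have hlast : ∀ a b, (tourPerm π).SameCycle (a, lastType k) (b, lastType k) := fun a b =>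
    Quotient.exact (s := s) (eq_of_sameCycle (F := fun a => Quotient.mk s (a, lastType k))
      (fun a => Quotient.sound (s := s) (hinv a)) (h a b))
  have hto : ∀ (t : Fin k) a, ∃ b, (tourPerm π).SameCycle (a, t) (b, lastType k) := by
    refine fun t => fin_forall_of_of_add_one
      (P := fun t => ∀ a, ∃ b, (tourPerm π).SameCycle (a, t) (b, lastType k))
      (fun t ht a => ?_) (fun a => ⟨a, Equiv.Perm.SameCycle.refl _ _⟩) t
    obtain ⟨b, hb⟩ := ht ((π (t + 1))⁻¹ a)
    exact ⟨b, Equiv.Perm.sameCycle_apply_left.1 hb⟩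
  obtain ⟨a, ha⟩ := hto x.2 x.1
  obtain ⟨b, hb⟩ := hto y.2 y.1
  exact (ha.trans (hlast a b)).trans hb.symm

theorem prod_relabel {π' : Fin k → Equiv.Perm (Fin n)} {h : Equiv.Perm (Fin n)}
    (hπ : ∀ t a, π' t (h a) = h (π t a)) (a : Fin n) :
    (List.ofFn π').prod (h a) = h ((List.ofFn π).prod a) := by
  have hconj : π' = fun t => MulAut.conj h (π t) := by
    funext t
    ext1 a
    obtain ⟨a, rfl⟩ := h.surjective a
    rw [hπ, MulAut.conj_apply, Equiv.Perm.mul_apply, Equiv.Perm.mul_apply, inv_apply_apply]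
  have hprod : (List.ofFn π').prod = MulAut.conj h (List.ofFn π).prod := by
    rw [map_list_prod, List.map_ofFn, hconj]
    rfl
  rw [hprod, MulAut.conj_apply, Equiv.Perm.mul_apply, Equiv.Perm.mul_apply, inv_apply_apply]

theorem finRotate_pow_apply {r : Fin n} (hr : r.val = 0) (i : Fin n) :
    (finRotate n ^ (i : ℕ)) r = i := by
  obtain ⟨m, rfl⟩ : ∃ m, n = m + 1 := ⟨n - 1, by have := r.2; omega⟩
  obtain ⟨i, hi⟩ := i
  simp only
  induction i with
  | zero => exact Fin.ext hr
  | succ i ih =>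
    rw [pow_succ', Equiv.Perm.mul_apply, ih (by omega), finRotate_of_lt (by omega)]

/-- Give the label `i` to the element `(P ^ i) r`. -/
theorem exists_conj_finRotate {P : Equiv.Perm (Fin n)} (hP : ∀ a b, P.SameCycle a b) (r : Fin n) :
    ∃ h : Equiv.Perm (Fin n), (h r).val = 0 ∧ ∀ a, finRotate n (h a) = h (P a) := by
  obtain ⟨m, rfl⟩ : ∃ m, n = m + 1 := ⟨n - 1, by have := r.2; omega⟩
  have hbij := bijective_pow_apply (hP r)
  have hcard := pow_card_apply (hP r)
  rw [Fintype.card_fin] at hbij hcard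
  let e : Equiv.Perm (Fin (m + 1)) := Equiv.ofBijective _ hbij
  have he : ∀ i, e i = (P ^ (i : ℕ)) r := fun _ => rfl
  have hrot : ∀ i, e (finRotate (m + 1) i) = P (e i) := by
    intro i
    rw [he, he, ← Equiv.Perm.mul_apply, ← pow_succ']
    rcases Nat.lt_or_ge i m with hlt | hge
    · rw [show finRotate (m + 1) i = ⟨i + 1, by omega⟩ from finRotate_of_lt hlt]
    · have hi : i = Fin.last m := Fin.ext (by have := i.2; simp only [Fin.val_last]; omega)
      rw [hi, finRotate_last, Fin.val_last, hcard]
      rfl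
  refine ⟨e.symm, ?_, fun a => ?_⟩
  · have : e 0 = r := rfl
    rw [← this, Equiv.symm_apply_apply]
    rfl
  · obtain ⟨i, rfl⟩ := e.surjective a
    rw [Equiv.symm_apply_apply, ← hrot, Equiv.symm_apply_apply]

/-- A permutation commuting with a transitive one is determined by one value. This makes the
labelling of the hyperedges of a rooted cactus unique. -/
theorem eq_one_of_commute_finRotate {h : Equiv.Perm (Fin n)}
    (hh : ∀ a, finRotate n (h a) = h (finRotate n a)) {r : Fin n} (hr : r.val = 0)
    (hhr : h r = r) : h = 1 := by
  have hpow : ∀ (i : ℕ) a, (finRotate n ^ i) (h a) = h ((finRotate n ^ i) a) := by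
    intro i
    induction i with
    | zero => intro a; rfl
    | succ i ih =>
      intro a
      rw [pow_succ', Equiv.Perm.mul_apply, ih, hh, Equiv.Perm.mul_apply]
  ext1 i
  have := hpow i r
  rw [hhr, finRotate_pow_apply hr] at this
  exact this.symm

end Products

/-! ### Coloured factorizations and coloured cacti -/

section Factorizations

variable {n k : ℕ} [NeZero k] {p : Fin k → ℕ}

theorem Constellation.Chart.rot_inv_rot_inv {C : Constellation k} {π : Fin k → Equiv.Perm (Fin n)}
    (g : C.Chart π) (a : Fin n) (t : Fin k) :
    C.rot⁻¹ (C.rot⁻¹ (g.toEquiv (a, t, true))) = g.toEquiv (π t a, t, true) := by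
  rw [Equiv.Perm.inv_eq_iff_eq, Equiv.Perm.inv_eq_iff_eq, g.rot_true, inv_apply_apply, g.rot_false]

theorem CactusData.encodes_iff (C : CactusData n p) (F : ColoredFactorization n p) :
    C.Encodes F ↔ ∃ r : Fin n, r.val = 0 ∧ C.IsModel F.perm F.color r := by
  constructor
  · rintro ⟨l, hr, hl⟩
    obtain ⟨π, φ, g, hg, hgl⟩ := exists_decorated_chart (root := C.root) C.color_fst l
    have hgl' : ∀ d h a t, d = g.toEquiv (a, t, true) → l (hyperedge d h) = a := by
      rintro d h a t rfl
      exact hgl a t h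
    have key : ∀ a t, F.perm t a = π t a ∧ F.color t a = φ t a := by
      intro a t
      have h1 := hl _ (g.black a t true)
      rw [g.typ, hgl, hgl' _ _ _ t (g.rot_inv_rot_inv a t), hg.color] at h1
      exact ⟨h1.1, (eq_of_heq (Sigma.mk.inj h1.2).2).symm⟩
    have hπ : F.perm = π := funext fun t => Equiv.ext fun a => (key a t).1
    have hφ : F.color = φ := funext fun t => funext fun a => (key a t).2
    refine ⟨l C.root, hr, ?_⟩
    rw [hπ, hφ]
    exact ⟨g, hg⟩
  · rintro ⟨r, hr, g, hg⟩
    let m : Fin n ≃ C.Hyperedge := Equiv.ofBijective _ g.hyperedge_bijective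
    let l : C.Hyperedge ≃ Fin n := m.symm
    have hl : ∀ d h a t, d = g.toEquiv (a, t, true) → l (hyperedge d h) = a := by
      rintro _ h a t rfl
      exact m.symm_apply_eq.2 (Subtype.ext (g.face_inj.2 rfl))
    refine ⟨l, ?_, fun d h => ?_⟩
    · have : l C.root = r := m.symm_apply_eq.2 (Subtype.ext hg.face_root.symm)
      rw [this, hr]
    · obtain ⟨a, t, rfl⟩ := g.exists_black h
      rw [g.typ, hl _ _ _ _ rfl, hl _ _ _ t (g.rot_inv_rot_inv a t)]
      exact ⟨rfl, hg.color a t⟩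

theorem ColoredFactorization.isTour (F : ColoredFactorization n p) {r : Fin n} (hr : r.val = 0) :
    IsTour (edgeSrc F.color) (shiftPerm n k) (tourPerm F.perm) where
  src_apply := by
    rintro ⟨a, t⟩
    rw [tourPerm_apply, shiftPerm_apply, edgeSrc, edgeSrc]
    congr 1
    exact F.color_eq _ _ _ ⟨1, by rw [zpow_one, apply_inv_apply]⟩
  sameCycle := by
    refine sameCycle_tourPerm_of_prod fun a b => ?_
    rw [F.prod_eq]
    have key : ∀ i, (finRotate n).SameCycle r i := fun i =>
      ⟨(i : ℕ), by rw [zpow_natCast]; exact finRotate_pow_apply hr i⟩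
    exact (key a).symm.trans (key b)

theorem ColoredFactorization.exists_encodes (hp : ∀ t, 0 < p t) (F : ColoredFactorization n p) :
    ∃ C : CactusData n p, C.Encodes F := by
  -- A colour in use forces `n > 0`, so the label `0` for the root exists; for `n = 0` there is no
  -- factorization at all.
  obtain ⟨a, -⟩ := F.color_surjective 0 ⟨0, hp 0⟩
  let r : Fin n := ⟨0, a.pos⟩
  obtain ⟨C, hC⟩ := CactusData.exists_of_isTour (F.isTour (r := r) rfl) (fun ⟨t, i⟩ => by
    obtain ⟨a, rfl⟩ := F.color_surjective t i
    exact ⟨(a, t), rfl⟩) r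
  exact ⟨C, (C.encodes_iff F).2 ⟨r, rfl, hC⟩⟩

theorem CactusData.exists_encodes (C : CactusData n p) :
    ∃ F : ColoredFactorization n p, C.Encodes F := by
  obtain ⟨π, φ, r, hC⟩ := C.exists_isModel
  obtain ⟨h, hr, hh⟩ := exists_conj_finRotate (sameCycle_prod_of_tourPerm hC.isTour.sameCycle) r
  let π' : Fin k → Equiv.Perm (Fin n) := fun t => h * π t * h⁻¹
  let φ' : (t : Fin k) → Fin n → Fin (p t) := fun t a => φ t (h⁻¹ a)
  have hrel : IsRelabelling h π φ r π' φ' (h r) := by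
    refine ⟨fun t a => ?_, fun t a => ?_, rfl⟩
    · simp only [π', Equiv.Perm.mul_apply, inv_apply_apply]
    · simp only [φ', inv_apply_apply]
  have hC' := hC.relabel hrel
  obtain ⟨g, hg⟩ := hC'
  refine ⟨⟨π', ?_, φ', fun t i => ?_, fun t a b hab => ?_⟩,
    (C.encodes_iff _).2 ⟨h r, hr, g, hg⟩⟩
  · ext1 a
    obtain ⟨a, rfl⟩ := h.surjective a
    rw [prod_relabel hrel.perm, hh]
  · obtain ⟨⟨a, s⟩, ha⟩ := hg.edgeSrc_surjective C.color_surjective ⟨t, i⟩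
    obtain rfl : s = t := congrArg Sigma.fst ha
    exact ⟨a, eq_of_heq (Sigma.mk.inj ha).2⟩
  · exact eq_of_sameCycle (hg.perm_color t) hab

theorem CactusData.toClass_eq_iff {C D : CactusData n p} : C.toClass = D.toClass ↔ C ≈ D :=
  Quotient.eq

theorem TreeRootedData.toClass_eq_iff {T U : TreeRootedData n p} :
    T.toClass = U.toClass ↔ T ≈ U :=
  Quotient.eq

theorem CactusData.Encodes.congr {C D : CactusData n p} {F : ColoredFactorization n p}
    (hC : C.Encodes F) (h : C ≈ D) : D.Encodes F := by
  rw [encodes_iff] at hC ⊢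
  obtain ⟨r, hr, hC⟩ := hC
  exact ⟨r, hr, hC.congr h⟩

theorem CactusData.Encodes.equiv {C D : CactusData n p} {F : ColoredFactorization n p}
    (hC : C.Encodes F) (hD : D.Encodes F) : C ≈ D := by
  rw [encodes_iff] at hC hD
  obtain ⟨r, hr, hC⟩ := hC
  obtain ⟨r', hr', hD⟩ := hD
  obtain rfl : r = r' := Fin.ext (hr.trans hr'.symm)
  exact hC.equiv hD

theorem CactusData.Encodes.unique {C : CactusData n p} {F F' : ColoredFactorization n p}
    (hF : C.Encodes F) (hF' : C.Encodes F') : F = F' := by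
  rw [encodes_iff] at hF hF'
  obtain ⟨r, hr, hF⟩ := hF
  obtain ⟨r', hr', hF'⟩ := hF'
  obtain ⟨h, hh⟩ := hF.exists_relabelling hF'
  obtain rfl : h = 1 := by
    refine eq_one_of_commute_finRotate (fun a => ?_) hr (hh.root.symm.trans (Fin.ext ?_))
    · rw [← F'.prod_eq, prod_relabel hh.perm, F.prod_eq, F'.prod_eq]
    · rw [hr, hr']
  have hperm : F'.perm = F.perm := funext fun t => Equiv.ext fun a => hh.perm t a
  have hcolor : F'.color = F.color := funext fun t => funext fun a => hh.color t a
  cases F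
  cases F'
  simp only at hperm hcolor
  subst hperm hcolor
  rfl

end Factorizations

/-- A relation between representatives, total on both sides and matching the two equivalences,
descends to a bijection of the quotients. This avoids choosing labellings of hyperedges canonically.
-/
theorem exists_equiv_of_relation {X Y A B : Type*} {q : X → A} {q' : Y → B}
    (hq : Function.Surjective q) (hq' : Function.Surjective q') {R : X → Y → Prop}
    (hX : ∀ x, ∃ y, R x y) (hY : ∀ y, ∃ x, R x y)
    (hR : ∀ x x' y y', R x y → R x' y' → (q x = q x' ↔ q' y = q' y')) :
    ∃ e : A ≃ B, ∀ x y, R x y → e (q x) = q' y := by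
  choose f hf using hX
  have hrep : ∀ a, q (Function.surjInv hq a) = a := Function.surjInv_eq hq
  let F : A → B := fun a => q' (f (Function.surjInv hq a))
  have hF : ∀ x y, R x y → F (q x) = q' y := fun x y h => (hR _ _ _ _ (hf _) h).1 (hrep _)
  refine ⟨Equiv.ofBijective F ⟨fun a a' h => ?_, fun b => ?_⟩, hF⟩
  · rw [← hrep a, ← hrep a']
    exact (hR _ _ _ _ (hf _) (hf _)).2 h
  · obtain ⟨y, rfl⟩ := hq' b
    obtain ⟨x, hx⟩ := hY y
    exact ⟨q x, hF x y hx⟩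

/-! ### The correspondence on isomorphism classes -/

section Correspondence

variable {n k : ℕ} [NeZero k] {p : Fin k → ℕ}

/-- For some labelling of the hyperedges, the tour around the white face of `C` starting at the root
leaves each vertex in the order given by `T`, the last exits forming the arborescence of `T`. -/
def Corresponds (C : CactusData n p) (T : TreeRootedData n p) : Prop :=
  ∃ π φ r ρ A, C.IsModel π φ r ∧ T.IsModel ρ φ r A ∧
    BestRel (edgeSrc φ) (r, lastType k) (tourPerm π) (rotPerm ρ) A

theorem CactusData.exists_corresponds (C : CactusData n p) :
    ∃ T : TreeRootedData n p, Corresponds C T := by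
  obtain ⟨π, φ, r, hC⟩ := C.exists_isModel
  obtain ⟨σ, A, hσ, hA, hbest⟩ :=
    exists_rotation_of_tour hC.edgeSrc_surjective hC.isTour (r, lastType k)
  obtain ⟨ρ, rfl⟩ := exists_rotPerm_eq_of_isRotation hσ
  obtain ⟨T, hT⟩ := TreeRootedData.exists_of_isOutTree hσ hA hC.edgeSrc_surjective
  exact ⟨T, π, φ, r, ρ, A, hC, hT, hbest⟩

theorem TreeRootedData.exists_corresponds (T : TreeRootedData n p) :
    ∃ C : CactusData n p, Corresponds C T := by
  obtain ⟨ρ, φ, r, A, hT⟩ := T.exists_isModel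
  obtain ⟨τ, hτ, hbest⟩ :=
    exists_tour_of_rotation (shiftPerm n k).bijective hT.isRotation hT.isOutTree
  obtain ⟨π, rfl⟩ := exists_tourPerm_eq_of_isTour hτ
  obtain ⟨C, hC⟩ := CactusData.exists_of_isTour hτ hT.edgeSrc_surjective r
  exact ⟨C, π, φ, r, ρ, A, hC, hT, hbest⟩

theorem bestRel_relabel {π π' ρ ρ' : Fin k → Equiv.Perm (Fin n)}
    {φ φ' : (t : Fin k) → Fin n → Fin (p t)} {r r' : Fin n} {A A' : Set (Fin n × Fin k)}
    (hbest : BestRel (edgeSrc φ) (r, lastType k) (tourPerm π) (rotPerm ρ) A)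
    {h : Equiv.Perm (Fin n)} (hπ : IsRelabelling h π φ r π' φ' r')
    (hρ : ∀ t a, ρ' t (h a) = h (ρ t a)) (hA : ∀ a t, (h a, t) ∈ A' ↔ (a, t) ∈ A) :
    BestRel (edgeSrc φ') (r', lastType k) (tourPerm π') (rotPerm ρ') A' := by
  have := hbest.map (Equiv.prodCongr h (Equiv.refl (Fin k))) (src' := edgeSrc φ')
    (τ' := tourPerm π') (σ' := rotPerm ρ') (A' := A')
    (fun x => congrArg (Sigma.mk x.2) (hπ.color x.2 x.1))
    (fun x => by
      refine Prod.ext ?_ rfl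
      change (π' (x.2 + 1))⁻¹ (h x.1) = h ((π (x.2 + 1))⁻¹ x.1)
      rw [Equiv.Perm.inv_eq_iff_eq, hπ.perm, apply_inv_apply])
    (fun x => Prod.ext (hρ x.2 x.1) rfl) (fun x => hA x.1 x.2)
  rw [hπ.root]
  exact this

/-- An isomorphism on one side gives a relabelling; carrying the data of the other side along it
places both pairs on the same labels, where uniqueness in the BEST correspondence applies. -/
theorem Corresponds.equiv_iff {C C' : CactusData n p} {T T' : TreeRootedData n p}
    (h : Corresponds C T) (h' : Corresponds C' T') : C ≈ C' ↔ T ≈ T' := by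
  obtain ⟨π, φ, r, ρ, A, hC, hT, hbest⟩ := h
  obtain ⟨π', φ', r', ρ', A', hC', hT', hbest'⟩ := h'
  constructor
  · intro hCC
    obtain ⟨h, hh⟩ := (hC.congr hCC).exists_relabelling hC'
    let ρ'' : Fin k → Equiv.Perm (Fin n) := fun t => h * ρ t * h⁻¹
    let A'' : Set (Fin n × Fin k) := {x | (h⁻¹ x.1, x.2) ∈ A}
    have hρ : ∀ t a, ρ'' t (h a) = h (ρ t a) := fun t a => by
      simp only [ρ'', Equiv.Perm.mul_apply, inv_apply_apply]
    have hA : ∀ a t, (h a, t) ∈ A'' ↔ (a, t) ∈ A := fun a t => by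
      simp only [A'', Set.mem_ofPred_eq, inv_apply_apply]
    have hT'' := hT.relabel (ρ' := ρ'') ⟨hρ, hh.color, hh.root⟩ hA
    obtain ⟨h1, h2⟩ := (bestRel_relabel hbest hh hρ hA).unique_rotation hC'.isTour hT''.isRotation
      hT''.isOutTree hT'.isRotation hT'.isOutTree hbest'
    rw [rotPerm_injective h1, h2] at hT''
    exact hT''.equiv hT'
  · intro hTT
    obtain ⟨h, hh, hA⟩ := (hT.congr hTT).exists_relabelling hT'
    let π'' : Fin k → Equiv.Perm (Fin n) := fun t => h * π t * h⁻¹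
    have hπ : ∀ t a, π'' t (h a) = h (π t a) := fun t a => by
      simp only [π'', Equiv.Perm.mul_apply, inv_apply_apply]
    have hrel : IsRelabelling h π φ r π'' φ' r' := ⟨hπ, hh.color, hh.root⟩
    have hC'' := hC.relabel hrel
    have h1 := (bestRel_relabel hbest hrel hh.perm hA).unique_tour hC''.isTour hC'.isTour hbest'
    rw [tourPerm_injective h1] at hC''
    exact hC''.equiv hC'

theorem Corresponds.edgeCount_eq {C : CactusData n p} {T : TreeRootedData n p}
    (h : Corresponds C T) (t : Fin k) (i : Fin (p t)) (j : Fin (p (t + 1))) :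
    edgeCount C.color t i j = edgeCount T.label t i j := by
  obtain ⟨π, φ, r, ρ, A, ⟨g, hg⟩, ⟨g', hg', -⟩, -⟩ := h
  rw [hg.edgeCount_eq, hg'.edgeCount_eq]

theorem Corresponds.congr {C : CactusData n p} {T T' : TreeRootedData n p}
    (h : Corresponds C T) (hT : T ≈ T') : Corresponds C T' := by
  obtain ⟨π, φ, r, ρ, A, h1, h2, h3⟩ := h
  exact ⟨π, φ, r, ρ, A, h1, h2.congr hT, h3⟩

end Correspondence

end TreeRooted

theorem theorem3p1 {k : ℕ} [NeZero k] (n : ℕ) (p : Fin k → ℕ) (hp : ∀ t, 0 < p t) :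
    (∃ Ψ : TreeRooted.ColoredFactorization n p ≃ TreeRooted.ColoredRootedCacti n p,
      ∀ (F : TreeRooted.ColoredFactorization n p) (C : TreeRooted.CactusData n p),
        Ψ F = C.toClass ↔ C.Encodes F) ∧
    ∃ Φ : TreeRooted.ColoredRootedCacti n p ≃ TreeRooted.TreeRootedConstellations n p,
      ∀ (C : TreeRooted.CactusData n p) (T : TreeRooted.TreeRootedData n p),
        Φ C.toClass = T.toClass →
        ∀ (t : Fin k) (i : Fin (p t)) (j : Fin (p (t + 1))),
          TreeRooted.Constellation.edgeCount C.color t i j =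
            TreeRooted.Constellation.edgeCount T.label t i j := by
  have hC : Function.Surjective (TreeRooted.CactusData.toClass (n := n) (p := p)) :=
    Quotient.mk_surjective
  have hT : Function.Surjective (TreeRooted.TreeRootedData.toClass (n := n) (p := p)) :=
    Quotient.mk_surjective
  constructor
  -- Factorizations carry explicit labels, so on their side no quotient is taken and `q` is `id`.
  · obtain ⟨Ψ, hΨ⟩ := TreeRooted.exists_equiv_of_relation (q := id) Function.surjective_id hC
      (R := fun (F : TreeRooted.ColoredFactorization n p) C => C.Encodes F)
      (fun F => F.exists_encodes hp) (fun C => C.exists_encodes) (fun F F' C C' h h' => by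
        rw [TreeRooted.CactusData.toClass_eq_iff]
        refine ⟨fun hF => ?_, fun hCC => (h.congr hCC).unique h'⟩
        obtain rfl : F = F' := hF
        exact h.equiv h')
    refine ⟨Ψ, fun F C => ⟨fun h => ?_, hΨ F C⟩⟩
    obtain ⟨D, hD⟩ := F.exists_encodes hp
    refine hD.congr (TreeRooted.CactusData.toClass_eq_iff.1 ?_)
    rw [← h]
    exact (hΨ F D hD).symm
  · obtain ⟨Φ, hΦ⟩ := TreeRooted.exists_equiv_of_relation hC hT
      (R := TreeRooted.Corresponds) (fun C => C.exists_corresponds)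
      (fun T => T.exists_corresponds) (fun C C' T T' h h' => by
        rw [TreeRooted.CactusData.toClass_eq_iff, TreeRooted.TreeRootedData.toClass_eq_iff]
        exact h.equiv_iff h')
    refine ⟨Φ, fun C T h => ?_⟩
    -- The given `T` is only isomorphic to a partner `U` of `C`, so the correspondence is
    -- transported from `U` to `T`.
    obtain ⟨U, hU⟩ := C.exists_corresponds
    refine (hU.congr (TreeRooted.TreeRootedData.toClass_eq_iff.1 ?_)).edgeCount_eq
    rw [← h, hΦ C U hU]
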